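/- Let $d\ge 3$ be an integer, and write $B_r$ for the open ball of radius $r$ centered at the origin of $\mathbb{R}^d$. There exist constants $c'>0$ and $C'>0$, depending only on $d$, such that the following holds. Let $\Lambda\in[1,\infty)$ and let $\mathbf{a}\colon B_1\to\mathbb{R}^{d\times d}$ be measurable (not necessarily symmetric), with $$\xi\cdot\mathbf{a}(x)\xi\ \ge\ |\xi|^2\qquad\text{and}\qquad \xi\cdot\mathbf{a}(x)^{-1}\xi\ \ge\ \Lambda^{-1}|\xi|^2$$ for almost every $x\in B_1$ and every $\xi\in\mathbb{R}^d$. Let $u\in W^{1,2}(B_1)$ satisfy $u>0$ almost everywhere in $B_1$ and be a weak supersolution of $-\nabla\cdot(\mathbf{a}\nabla u)\ge 0$ on $B_1$, that is, $$\int_{B_1}\nabla\varphi\cdot\mathbf{a}\nabla u\,dx\ \ge\ 0\qquad\text{for every nonnegative }\varphi\in W^{1,2}_0(B_1),$$ where $W^{1,2}_0(B_1)$ is the closure of $C_c^\infty(B_1)$ in $W^{1,2}(B_1)$. Then, with $c:=c'/\Lambda^{1/2}$, the functions $|u|^{c}$ and $|u|^{-c}$ are integrable on $B_{1/2}$, and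 $$\Bigl(\frac{1}{|B_{1/2}|}\int_{B_{1/2}}|u|^{c}\,dx\Bigr)\Bigl(\frac{1}{|B_{1/2}|}\int_{B_{1/2}}|u|^{-c}\,dx\Bigr)\ \le\ C'.$$ -/

import Mathlib

open MeasureTheory TopologicalSpace
open scoped ENNReal Matrix Distributions

namespace EllipticPDE

/-- `g` is a weak partial derivative of `f` in the `i`-th coordinate direction on the open set `Ω`.
Both functions are required to be locally integrable on `Ω`, so that the two integrals below are
meaningful; only the values of `f` and `g` on `Ω` matter. -/
def IsWeakPartialDeriv {d : ℕ} (Ω : Opens (EuclideanSpace ℝ (Fin d))) (i : Fin d)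
    (f g : EuclideanSpace ℝ (Fin d) → ℝ) : Prop :=
  LocallyIntegrableOn f Ω ∧ LocallyIntegrableOn g Ω ∧
    ∀ φ : 𝓓(Ω, ℝ),
      ∫ x in Ω, f x * fderiv ℝ φ x (EuclideanSpace.single i 1) = - ∫ x in Ω, g x * φ x

/-- Weak partial derivatives are unique up to null sets. -/
theorem IsWeakPartialDeriv.ae_eq {d : ℕ} {Ω : Opens (EuclideanSpace ℝ (Fin d))} {i : Fin d}
    {f g h : EuclideanSpace ℝ (Fin d) → ℝ}
    (hg : IsWeakPartialDeriv Ω i f g) (hh : IsWeakPartialDeriv Ω i f h) :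
    g =ᵐ[volume.restrict Ω] h := by
  have key : ∀ᵐ x ∂(volume : Measure (EuclideanSpace ℝ (Fin d))),
      x ∈ (Ω : Set (EuclideanSpace ℝ (Fin d))) → (g - h) x = 0 := by
    refine Ω.isOpen.ae_eq_zero_of_integral_contDiff_smul_eq_zero (hg.2.1.sub hh.2.1) ?_
    intro φ hφ hc hs
    have hint : ∀ k : EuclideanSpace ℝ (Fin d) → ℝ, LocallyIntegrableOn k Ω →
        IntegrableOn (fun x => k x * φ x) Ω := by
      intro k hk
      have h1 : IntegrableOn (fun x => k x * φ x) (tsupport φ) :=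
        (hk.integrableOn_compact_subset hs hc).mul_continuousOn hφ.continuous.continuousOn hc
      have h2 : Integrable (fun x => k x * φ x) := by
        refine (integrableOn_iff_integrable_of_support_subset ?_).1 h1
        intro x hx
        exact subset_tsupport φ (right_ne_zero_of_mul hx)
      exact h2.integrableOn
    have e : ∫ x in Ω, g x * φ x = ∫ x in Ω, h x * φ x := by
      have a := hg.2.2 ⟨φ, hφ, hc, hs⟩
      have b := hh.2.2 ⟨φ, hφ, hc, hs⟩
      exact neg_injective (a.symm.trans b)
    have e2 : ∫ x in Ω, φ x • (g - h) x = 0 := by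
      rw [← sub_eq_zero, ← integral_sub (hint g hg.2.1) (hint h hh.2.1)] at e
      rw [← e]
      congr 1
      funext x
      simp only [Pi.sub_apply, smul_eq_mul]
      ring
    rw [← e2]
    symm
    refine setIntegral_eq_integral_of_forall_compl_eq_zero ?_
    intro x hx
    have : φ x = 0 := by
      by_contra hne
      exact hx (hs (subset_tsupport φ hne))
    simp [this]
  rw [Filter.EventuallyEq, ae_restrict_iff' Ω.isOpen.measurableSet]
  filter_upwards [key] with x hx hxΩ
  exact sub_eq_zero.1 (hx hxΩ)

/-- The Sobolev space `W^{1,p}(Ω)`: functions in `L^p(Ω)` all of whose weak partial derivatives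
exist and belong to `L^p(Ω)`. -/
def MemW1 {d : ℕ} (Ω : Opens (EuclideanSpace ℝ (Fin d))) (p : ℝ≥0∞)
    (f : EuclideanSpace ℝ (Fin d) → ℝ) : Prop :=
  MemLp f p (volume.restrict Ω) ∧
    ∀ i, ∃ g, IsWeakPartialDeriv Ω i f g ∧ MemLp g p (volume.restrict Ω)

open Classical in
/-- The weak gradient of `f` on `Ω`, in coordinates (well defined up to null sets by
`IsWeakPartialDeriv.ae_eq`; a coordinate is `0` if the weak partial derivative does not exist,
which never happens for `f ∈ W^{1,p}(Ω)`). -/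
noncomputable def weakGrad {d : ℕ} (Ω : Opens (EuclideanSpace ℝ (Fin d)))
    (f : EuclideanSpace ℝ (Fin d) → ℝ) (x : EuclideanSpace ℝ (Fin d)) (i : Fin d) : ℝ :=
  if h : ∃ g, IsWeakPartialDeriv Ω i f g then h.choose x else 0

/-- The weak gradient is the family of weak partial derivatives whenever these exist. -/
theorem weakGrad_ae_eq {d : ℕ} {Ω : Opens (EuclideanSpace ℝ (Fin d))} {i : Fin d}
    {f g : EuclideanSpace ℝ (Fin d) → ℝ} (hg : IsWeakPartialDeriv Ω i f g) :
    (fun x => weakGrad Ω f x i) =ᵐ[volume.restrict Ω] g := by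
  have h : ∃ g, IsWeakPartialDeriv Ω i f g := ⟨g, hg⟩
  have e : (fun x => weakGrad Ω f x i) = h.choose := by
    funext x
    simp only [weakGrad, dif_pos h]
  rw [e]
  exact h.choose_spec.ae_eq hg

/-- The space `W^{1,2}_0(Ω)`: the closure of `C_c^∞(Ω)` in the `W^{1,2}(Ω)` topology. -/
def MemW012 {d : ℕ} (Ω : Opens (EuclideanSpace ℝ (Fin d)))
    (f : EuclideanSpace ℝ (Fin d) → ℝ) : Prop :=
  MemW1 Ω 2 f ∧
    ∀ ε : ℝ≥0∞, 0 < ε → ∃ ψ : 𝓓(Ω, ℝ),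
      eLpNorm (fun x => f x - ψ x) 2 (volume.restrict Ω) ≤ ε ∧
      ∀ i, eLpNorm (fun x => weakGrad Ω f x i - fderiv ℝ ψ x (EuclideanSpace.single i 1)) 2
        (volume.restrict Ω) ≤ ε

/-- Elliptic coefficient fields on `Ω` with ellipticity constants `0 < lam ≤ Lam < ∞`: measurable
matrix fields, not necessarily symmetric, such that for almost every `x ∈ Ω` and every `ξ` one has
`ξ · a(x) ξ ≥ lam |ξ|²` and `ξ · a(x)⁻¹ ξ ≥ Lam⁻¹ |ξ|²`. The first bound makes `a(x)` invertible. -/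
structure IsEllipticCoeff {d : ℕ} (Ω : Opens (EuclideanSpace ℝ (Fin d))) (lam Lam : ℝ)
    (a : EuclideanSpace ℝ (Fin d) → Matrix (Fin d) (Fin d) ℝ) : Prop where
  measurable : ∀ i j, AEMeasurable (fun x => a x i j) (volume.restrict Ω)
  lam_pos : 0 < lam
  lam_le : lam ≤ Lam
  coercive : ∀ᵐ x ∂(volume.restrict (Ω : Set (EuclideanSpace ℝ (Fin d)))), ∀ ξ : Fin d → ℝ,
    lam * (ξ ⬝ᵥ ξ) ≤ ξ ⬝ᵥ (a x *ᵥ ξ)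
  coercive_inv : ∀ᵐ x ∂(volume.restrict (Ω : Set (EuclideanSpace ℝ (Fin d)))), ∀ ξ : Fin d → ℝ,
    Lam⁻¹ * (ξ ⬝ᵥ ξ) ≤ ξ ⬝ᵥ ((a x)⁻¹ *ᵥ ξ)

/-- The bilinear form `B_a(u, φ) = ∫_Ω ∇φ · a ∇u`. -/
noncomputable def bilinForm {d : ℕ} (Ω : Opens (EuclideanSpace ℝ (Fin d)))
    (a : EuclideanSpace ℝ (Fin d) → Matrix (Fin d) (Fin d) ℝ)
    (u φ : EuclideanSpace ℝ (Fin d) → ℝ) : ℝ :=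
  ∫ x in Ω, weakGrad Ω φ x ⬝ᵥ (a x *ᵥ weakGrad Ω u x)

/-- `u` is a weak supersolution of `-∇ · (a ∇u) ≥ 0` on `Ω`. -/
def IsWeakSupersolution {d : ℕ} (Ω : Opens (EuclideanSpace ℝ (Fin d)))
    (a : EuclideanSpace ℝ (Fin d) → Matrix (Fin d) (Fin d) ℝ)
    (u : EuclideanSpace ℝ (Fin d) → ℝ) : Prop :=
  MemW1 Ω 2 u ∧
    ∀ φ : EuclideanSpace ℝ (Fin d) → ℝ, MemW012 Ω φ →
      (∀ᵐ x ∂(volume.restrict (Ω : Set (EuclideanSpace ℝ (Fin d)))), 0 ≤ φ x) →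
      0 ≤ bilinForm Ω a u φ

/-- The open unit ball `B_1` centered at the origin. -/
def unitBall (d : ℕ) : Opens (EuclideanSpace ℝ (Fin d)) :=
  ⟨Metric.ball 0 1, Metric.isOpen_ball⟩

end EllipticPDE

/-!
The inequality expresses that `log u` has mean oscillation of order `Λ^{1/2}` at every scale, hence
is exponentially integrable with exponent of order `Λ^{-1/2}`; then `u^c` and `u^{-c}` have
integrals whose product is bounded, because `exp (c (log u - m))` and `exp (-c (log u - m))` are
both integrable, `m` being the mean of `log u` over the ball.

Testing the equation with `η² / (u + ε)` and absorbing the cross term by means of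
`|a ξ|² ≤ Λ ξ · a ξ` gives `∫ η² |∇ log (u + ε)|² ≤ 4 Λ ∫ |∇η|²`
(`lintegral_sq_mul_log_grad_le`). With cutoff functions adapted to balls and Cauchy–Schwarz this
becomes the Morrey bound `∫_{B(x,r)} |∇ log (u + ε)| ≤ K rᵈ⁻¹` with `K` proportional to `Λ^{1/2}`
(`exists_lintegral_ball_logGrad_le`).

In place of the John–Nirenberg inequality, the oscillation of a function around its mean is
estimated by the potential `∫₀¹ t⁻ᵈ ∫_{B(x,t)} |∇v| dt` of its gradient
(`lintegral_enorm_sub_le_ballPotential`, and `ae_lintegral_enorm_log_sub_le` for `v = log (u + ε)`).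
The Morrey bound controls the scales between `s` and `1` pointwise by `K log (1/s)`, while the
scales below `s` have integral of order `K s`. Taking `s = exp (-N)`, the set where the potential
exceeds `K (N + 1)` has measure of order `exp (-N)` (`measure_lt_ballPotential_le`), which is the
exponential integrability `lintegral_exp_le`. Finally `ε → 0` by Fatou's lemma
(`lintegral_rpow_mul_le_of_add`).

Weak derivatives are handled by mollification: smooth functions are substituted both in the test
function and in the potential estimate, and the limits use the `L²` convergence of mollified
gradients (`tendsto_lintegral_sq_mollify`, `tendsto_lintegral_sq_mul`).
-/

namespace EllipticPDE

open Metric Set Filter Topology Module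

/-! ### Potentials over balls and exponential integrability -/

section BallPotential

variable {E : Type*} [NormedAddCommGroup E] [NormedSpace ℝ E] [FiniteDimensional ℝ E]
  [MeasurableSpace E] [BorelSpace E] (μ : Measure E) [μ.IsAddHaarMeasure]

/-- The truncated potential `∫₀ˢ t⁻ᵈ ∫_{B(x,t)} h dμ dt`, where `d` is the dimension of `E`. Up to a
dimensional factor and the truncation it is the Riesz potential of order one of `h`; writing it as
an integral over radii makes its behaviour at small and at large scales directly visible. The factor
`t⁻ᵈ` is an inverse in `ℝ≥0∞`, finite because `t > 0` on the domain of integration. -/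
noncomputable def ballPotential (s : ℝ) (h : E → ℝ≥0∞) (x : E) : ℝ≥0∞ :=
  ∫⁻ t in Ioo 0 s, (ENNReal.ofReal (t ^ finrank ℝ E))⁻¹ * ∫⁻ z in ball x t, h z ∂μ

theorem measurable_lintegral_ball {h : E → ℝ≥0∞} (hh : Measurable h) :
    Measurable fun p : E × ℝ => ∫⁻ z in ball p.1 p.2, h z ∂μ := by
  have hs : MeasurableSet {q : (E × ℝ) × E | dist q.2 q.1.1 < q.1.2} :=
    measurableSet_lt (by fun_prop) (by fun_prop)
  have e : (fun p : E × ℝ => ∫⁻ z in ball p.1 p.2, h z ∂μ) = fun p : E × ℝ =>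
      ∫⁻ z, {q : (E × ℝ) × E | dist q.2 q.1.1 < q.1.2}.indicator (fun q => h q.2) (p, z) ∂μ := by
    funext p
    rw [← lintegral_indicator measurableSet_ball]
    rfl
  rw [e]
  exact ((hh.comp measurable_snd).indicator hs).lintegral_prod_right'

theorem measurable_ballPotential_integrand {h : E → ℝ≥0∞} (hh : Measurable h) :
    Measurable fun p : E × ℝ =>
      (ENNReal.ofReal (p.2 ^ finrank ℝ E))⁻¹ * ∫⁻ z in ball p.1 p.2, h z ∂μ :=
  Measurable.mul (by fun_prop) (measurable_lintegral_ball μ hh)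

theorem measurable_ballPotential {h : E → ℝ≥0∞} (hh : Measurable h) (s : ℝ) :
    Measurable (ballPotential μ s h) :=
  (measurable_ballPotential_integrand μ hh).lintegral_prod_right'

omit [FiniteDimensional ℝ E] [BorelSpace E] [μ.IsAddHaarMeasure] in
/-- Monotonicity only needs an almost everywhere inequality, as balls are integrated over. -/
theorem ballPotential_mono {s : ℝ} {h k : E → ℝ≥0∞} (hk : ∀ᵐ z ∂μ, h z ≤ k z) (x : E) :
    ballPotential μ s h x ≤ ballPotential μ s k x :=
  lintegral_mono fun _ => mul_le_mul_right (lintegral_mono_ae (ae_restrict_of_ae hk)) _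

theorem ballPotential_add {s : ℝ} {h k : E → ℝ≥0∞} (hh : Measurable h) (x : E) :
    ballPotential μ s (fun z => h z + k z) x
      = ballPotential μ s h x + ballPotential μ s k x := by
  unfold ballPotential
  simp_rw [lintegral_add_left hh, mul_add]
  have hm : Measurable fun t : ℝ =>
      (ENNReal.ofReal (t ^ finrank ℝ E))⁻¹ * ∫⁻ z in ball x t, h z ∂μ :=
    Measurable.mul (by fun_prop)
      ((measurable_lintegral_ball μ hh).comp (measurable_const.prodMk measurable_id))
  rw [lintegral_add_left hm]

/-- By Tonelli, each scale `t` contributes `t⁻ᵈ μ(B(z,t)) = μ(B(0,1))` to the mass at `z`, so scales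
below `s` contribute an amount proportional to `s`. -/
theorem lintegral_ballPotential {h : E → ℝ≥0∞} (hh : Measurable h) (s : ℝ) :
    ∫⁻ x, ballPotential μ s h x ∂μ = ENNReal.ofReal s * (μ (ball 0 1) * ∫⁻ z, h z ∂μ) := by
  unfold ballPotential
  rw [lintegral_lintegral_swap (measurable_ballPotential_integrand μ hh).aemeasurable]
  have key : ∀ t ∈ Ioo 0 s, ∫⁻ x, (ENNReal.ofReal (t ^ finrank ℝ E))⁻¹ *
      ∫⁻ z in ball x t, h z ∂μ ∂μ = μ (ball 0 1) * ∫⁻ z, h z ∂μ := by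
    intro t ht
    have hm : Measurable fun x : E => ∫⁻ z in ball x t, h z ∂μ :=
      (measurable_lintegral_ball μ hh).comp (measurable_id.prodMk measurable_const)
    rw [lintegral_const_mul _ hm]
    have hs : MeasurableSet {q : E × E | dist q.2 q.1 < t} :=
      measurableSet_lt (by fun_prop) (by fun_prop)
    have e1 : ∀ x : E, ∫⁻ z in ball x t, h z ∂μ
        = ∫⁻ z, {q : E × E | dist q.2 q.1 < t}.indicator (fun q => h q.2) (x, z) ∂μ := by
      intro x
      rw [← lintegral_indicator measurableSet_ball]
      rfl
    have e2 : ∀ z : E, ∫⁻ x, {q : E × E | dist q.2 q.1 < t}.indicator (fun q => h q.2) (x, z) ∂μ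
        = h z * μ (ball z t) := by
      intro z
      rw [← lintegral_indicator_const measurableSet_ball]
      refine lintegral_congr fun x => ?_
      simp [indicator, dist_comm]
    simp_rw [e1]
    have hF : Measurable (Function.uncurry fun x z : E =>
        {q : E × E | dist q.2 q.1 < t}.indicator (fun q => h q.2) (x, z)) :=
      (hh.comp measurable_snd).indicator hs
    rw [lintegral_lintegral_swap hF.aemeasurable]
    simp_rw [e2, Measure.addHaar_ball_of_pos μ _ ht.1]
    rw [lintegral_mul_const _ hh]
    have hpos : ENNReal.ofReal (t ^ finrank ℝ E) ≠ 0 := by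
      simpa using pow_pos ht.1 _
    calc _ = ((ENNReal.ofReal (t ^ finrank ℝ E))⁻¹ * ENNReal.ofReal (t ^ finrank ℝ E))
          * (μ (ball 0 1) * ∫⁻ z, h z ∂μ) := by ring
      _ = _ := by rw [ENNReal.inv_mul_cancel hpos ENNReal.ofReal_ne_top, one_mul]
  rw [setLIntegral_congr_fun measurableSet_Ioo key, setLIntegral_const, mul_comm]
  simp

theorem lintegral_comp_homothety (x : E) {t : ℝ} (ht : 0 < t) {F : E → ℝ≥0∞}
    (hF : Measurable F) :
    ∫⁻ y, F (x + t • (y - x)) ∂μ = (ENNReal.ofReal (t ^ finrank ℝ E))⁻¹ * ∫⁻ z, F z ∂μ := by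
  rw [lintegral_sub_right_eq_self (fun y => F (x + t • y)) x]
  have h1 : ∫⁻ y, F (x + t • y) ∂μ = ∫⁻ y, F (x + y) ∂(μ.map (t • ·)) := by
    rw [lintegral_map (by fun_prop) (by fun_prop)]
  rw [h1, Measure.map_addHaar_smul μ ht.ne', lintegral_smul_measure,
    lintegral_add_left_eq_self F x, abs_of_pos (by positivity),
    ENNReal.ofReal_inv_of_pos (by positivity)]
  rfl

omit [FiniteDimensional ℝ E] [MeasurableSpace E] [BorelSpace E] in
theorem enorm_sub_le_lintegral_fderiv {w : E → ℝ} (hw : ContDiff ℝ 1 w) (x y : E)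
    (hxy : dist x y ≤ 1) :
    ‖w x - w y‖ₑ ≤ ∫⁻ t in Ioo (0 : ℝ) 1, ‖fderiv ℝ w (x + t • (y - x))‖ₑ := by
  have hc : Continuous fun t : ℝ => fderiv ℝ w (x + t • (y - x)) (y - x) :=
    ((hw.continuous_fderiv one_ne_zero).comp (by fun_prop)).clm_apply continuous_const
  have hd : ∀ t : ℝ, HasDerivAt (fun t : ℝ => w (x + t • (y - x)))
      (fderiv ℝ w (x + t • (y - x)) (y - x)) t := by
    intro t
    have h1 : HasDerivAt (fun t : ℝ => x + t • (y - x)) (y - x) t := by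
      simpa using ((hasDerivAt_id t).smul_const (y - x)).const_add x
    exact ((hw.differentiable one_ne_zero _).hasFDerivAt).comp_hasDerivAt t h1
  have hi := intervalIntegral.integral_eq_sub_of_hasDerivAt (fun t _ => hd t)
    (hc.intervalIntegrable 0 1)
  have e : ‖w x - w y‖ₑ = ‖∫ t in Ioo (0 : ℝ) 1, fderiv ℝ w (x + t • (y - x)) (y - x)‖ₑ := by
    rw [← integral_Ioc_eq_integral_Ioo, ← intervalIntegral.integral_of_le zero_le_one, hi]
    simp only [one_smul, zero_smul, add_zero, add_sub_cancel]
    rw [← enorm_neg, neg_sub]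
  rw [e]
  refine (enorm_integral_le_lintegral_enorm _).trans ?_
  gcongr with t
  rw [← ofReal_norm, ← ofReal_norm]
  refine ENNReal.ofReal_le_ofReal ((ContinuousLinearMap.le_opNorm _ _).trans ?_)
  refine mul_le_of_le_one_right (norm_nonneg _) ?_
  rwa [← dist_eq_norm, dist_comm]

/-- The oscillation of a `C¹` function around a point of a convex set `B` of diameter at most one is
controlled by the potential of its gradient. The difference `w x - w y` is integrated along the
segment, and for each parameter `t` the homothety `y ↦ x + t (y - x)` maps `B` into `B ∩ B(x,t)`
with Jacobian `tᵈ`. -/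
theorem lintegral_enorm_sub_le_ballPotential {w : E → ℝ} (hw : ContDiff ℝ 1 w) {B : Set E}
    (hB : Convex ℝ B) (hBm : MeasurableSet B) (hd : ∀ x ∈ B, ∀ y ∈ B, dist x y < 1)
    {x : E} (hx : x ∈ B) :
    ∫⁻ y in B, ‖w x - w y‖ₑ ∂μ
      ≤ ballPotential μ 1 (B.indicator fun z => ‖fderiv ℝ w z‖ₑ) x := by
  have hc : Continuous fun z => ‖fderiv ℝ w z‖ₑ := (hw.continuous_fderiv one_ne_zero).enorm
  calc ∫⁻ y in B, ‖w x - w y‖ₑ ∂μ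
      ≤ ∫⁻ y in B, (∫⁻ t in Ioo (0 : ℝ) 1, ‖fderiv ℝ w (x + t • (y - x))‖ₑ) ∂μ :=
        setLIntegral_mono' hBm fun y hy =>
          enorm_sub_le_lintegral_fderiv hw x y (hd x hx y hy).le
    _ = ∫⁻ t in Ioo (0 : ℝ) 1, ∫⁻ y in B, ‖fderiv ℝ w (x + t • (y - x))‖ₑ ∂μ := by
        refine lintegral_lintegral_swap (Continuous.measurable ?_).aemeasurable
        exact hc.comp (by fun_prop)
    _ ≤ _ := by
        refine setLIntegral_mono' measurableSet_Ioo fun t ht => ?_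
        rw [← lintegral_indicator measurableSet_ball,
          ← lintegral_comp_homothety μ x ht.1
            ((hc.measurable.indicator hBm).indicator measurableSet_ball),
          ← lintegral_indicator hBm]
        refine lintegral_mono fun y => ?_
        by_cases hy : y ∈ B
        · have h1 : x + t • (y - x) ∈ B := hB.add_smul_sub_mem hx hy ⟨ht.1.le, ht.2.le⟩
          have h2 : x + t • (y - x) ∈ ball x t := by
            rw [mem_ball, dist_eq_norm, add_sub_cancel_left, norm_smul, Real.norm_of_nonneg ht.1.le,
              ← dist_eq_norm, dist_comm]
            exact mul_lt_of_lt_one_right ht.1 (hd x hx y hy)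
          rw [indicator_of_mem hy, indicator_of_mem h2, indicator_of_mem h1]
        · simp [hy]

theorem lintegral_Ico_ofReal_inv {s : ℝ} (hs : 0 < s) (hs1 : s ≤ 1) :
    ∫⁻ t in Ico s 1, ENNReal.ofReal t⁻¹ = ENNReal.ofReal (Real.log s⁻¹) := by
  have hint : IntervalIntegrable (fun t : ℝ => t⁻¹) volume s 1 :=
    intervalIntegral.intervalIntegrable_inv (fun t ht => by
      rw [uIcc_of_le hs1] at ht; exact (hs.trans_le ht.1).ne') continuousOn_id
  have e : ∫ t in s..1, t⁻¹ = Real.log s⁻¹ := by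
    rw [integral_inv_of_pos hs one_pos, one_div]
  rw [← e, intervalIntegral.integral_of_le hs1, ← restrict_Ico_eq_restrict_Ioc,
    ofReal_integral_eq_lintegral_ofReal]
  · rw [intervalIntegrable_iff_integrableOn_Ioc_of_le hs1] at hint
    rw [restrict_Ico_eq_restrict_Ioc]
    exact hint
  · refine (ae_restrict_iff' measurableSet_Ico).2 (ae_of_all _ fun t ht => ?_)
    exact inv_nonneg.2 (hs.le.trans ht.1)

omit [FiniteDimensional ℝ E] [BorelSpace E] [μ.IsAddHaarMeasure] in
/-- Under the Morrey condition `∫_{B(x,r)} h ≤ K rᵈ⁻¹`, the scales between `s` and `1` contribute at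
most `K ∫ₛ¹ dt / t`. The condition is stated multiplied by `r`, which avoids the exponent `d - 1`.
-/
theorem ballPotential_le_add_log {h : E → ℝ≥0∞} {K : ℝ≥0∞} {x : E}
    (hK : ∀ r ∈ Ioo (0 : ℝ) 1, (∫⁻ z in ball x r, h z ∂μ) * ENNReal.ofReal r
      ≤ K * ENNReal.ofReal (r ^ finrank ℝ E))
    {s : ℝ} (hs : 0 < s) (hs1 : s ≤ 1) :
    ballPotential μ 1 h x ≤ ballPotential μ s h x + K * ENNReal.ofReal (Real.log s⁻¹) := by
  unfold ballPotential
  have hU : Ioo (0 : ℝ) 1 = Ioo 0 s ∪ Ico s 1 := (Ioo_union_Ico_eq_Ioo hs hs1).symm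
  rw [hU]
  refine (lintegral_union_le _ _ _).trans ?_
  gcongr
  rw [← lintegral_Ico_ofReal_inv hs hs1, ← lintegral_const_mul _ (by fun_prop)]
  refine setLIntegral_mono' measurableSet_Ico fun t ht => ?_
  have ht0 : 0 < t := hs.trans_le ht.1
  have h0 : ENNReal.ofReal t ≠ 0 := by simpa using ht0
  have h0' : ENNReal.ofReal (t ^ finrank ℝ E) ≠ 0 := by simpa using pow_pos ht0 _
  rw [ENNReal.ofReal_inv_of_pos ht0, ← div_eq_mul_inv K, ENNReal.le_div_iff_mul_le
    (Or.inl h0) (Or.inl ENNReal.ofReal_ne_top), mul_assoc, mul_comm, ← div_eq_mul_inv,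
    ENNReal.div_le_iff_le_mul (Or.inl h0') (Or.inl ENNReal.ofReal_ne_top)]
  exact hK t ⟨ht0, ht.2⟩

/-- Exponential decay of the distribution function of the potential of a Morrey function: with
`s = exp (-N)` the scales above `s` contribute at most `K N`, and Chebyshev's inequality applies to the
scales below `s`, whose total mass is proportional to `s`. -/
theorem measure_lt_ballPotential_le {h : E → ℝ≥0∞} (hh : Measurable h) {K : ℝ≥0∞}
    (hK0 : K ≠ 0) (hKt : K ≠ ∞) {B : Set E}
    (hK : ∀ x ∈ B, ∀ r ∈ Ioo (0 : ℝ) 1, (∫⁻ z in ball x r, h z ∂μ) * ENNReal.ofReal r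
      ≤ K * ENNReal.ofReal (r ^ finrank ℝ E))
    (hI : ∫⁻ z, h z ∂μ ≤ K) (N : ℕ) :
    μ {x | x ∈ B ∧ K * (N + 1) < ballPotential μ 1 h x}
      ≤ ENNReal.ofReal (Real.exp (-N)) * μ (ball 0 1) := by
  have hs : 0 < Real.exp (-N) := Real.exp_pos _
  have hsub : {x | x ∈ B ∧ K * (N + 1) < ballPotential μ 1 h x}
      ⊆ {x | K ≤ ballPotential μ (Real.exp (-N)) h x} := by
    rintro x ⟨hxB, hx⟩
    have h1 := ballPotential_le_add_log μ (hK x hxB) hs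
      (Real.exp_le_one_iff.2 (by simp))
    rw [← Real.exp_neg, neg_neg, Real.log_exp, ENNReal.ofReal_natCast] at h1
    by_contra hlt
    rw [mem_ofPred_eq, not_le] at hlt
    refine absurd (hx.trans_le h1) (not_lt.2 ?_)
    rw [mul_add, mul_one, add_comm]
    gcongr
  refine (measure_mono hsub).trans ?_
  have h2 := mul_meas_ge_le_lintegral (μ := μ)
    (measurable_ballPotential μ hh (Real.exp (-N))) K
  rw [lintegral_ballPotential μ hh] at h2
  have h3 : K * μ {x | K ≤ ballPotential μ (Real.exp (-N)) h x}
      ≤ K * (ENNReal.ofReal (Real.exp (-N)) * μ (ball 0 1)) := by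
    refine h2.trans ?_
    calc _ ≤ ENNReal.ofReal (Real.exp (-N)) * (μ (ball 0 1) * K) := by gcongr
      _ = _ := by ring
  exact (ENNReal.mul_le_mul_iff_right hK0 hKt).1 h3

/-- The bound for the exponential integral in `lintegral_exp_le`; it depends only on the space and
the Haar measure. -/
noncomputable def expConst : ℝ≥0∞ :=
  μ (ball (0 : E) 1) * (1 + ∑' N : ℕ,
    ENNReal.ofReal (Real.exp (3 / 2)) * ENNReal.ofReal (Real.exp (-(1 / 2))) ^ N)

omit [BorelSpace E] in
theorem expConst_ne_top : expConst μ ≠ ∞ := by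
  unfold expConst
  refine ENNReal.mul_ne_top measure_ball_lt_top.ne (ENNReal.add_ne_top.2 ⟨by simp, ?_⟩)
  rw [ENNReal.tsum_mul_left]
  refine ENNReal.mul_ne_top ENNReal.ofReal_ne_top ?_
  rw [ENNReal.tsum_geometric]
  refine ENNReal.inv_ne_top.2 (tsub_pos_of_lt ?_).ne'
  rw [ENNReal.ofReal_lt_one, Real.exp_lt_one_iff]
  norm_num

/-- Exponential integrability of functions dominated by the potential of a Morrey function. This
plays the role of the John–Nirenberg inequality. -/
theorem lintegral_exp_le {h : E → ℝ≥0∞} (hh : Measurable h) {K : ℝ} (hK0 : 0 < K)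
    {B : Set E} (hBm : MeasurableSet B) (hB : B ⊆ ball 0 1)
    (hK : ∀ x ∈ B, ∀ r ∈ Ioo (0 : ℝ) 1, (∫⁻ z in ball x r, h z ∂μ) * ENNReal.ofReal r
      ≤ ENNReal.ofReal K * ENNReal.ofReal (r ^ finrank ℝ E))
    (hI : ∫⁻ z, h z ∂μ ≤ ENNReal.ofReal K)
    {D : E → ℝ} (hD : AEMeasurable D (μ.restrict B))
    (hDh : ∀ᵐ x ∂μ.restrict B, ENNReal.ofReal (D x) ≤ ballPotential μ 1 h x) :
    ∫⁻ x in B, ENNReal.ofReal (Real.exp (D x / (2 * K))) ∂μ ≤ expConst μ := by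
  set A : ℕ → Set E := fun N => {x | K * N < D x} with hA
  have hAm : ∀ N, NullMeasurableSet (A N) (μ.restrict B) := fun N =>
    nullMeasurableSet_lt aemeasurable_const hD
  have hK0' : ENNReal.ofReal K ≠ 0 := by simpa using hK0
  have hAμ : ∀ N : ℕ, μ.restrict B (A N)
      ≤ ENNReal.ofReal (Real.exp (1 - N)) * μ (ball 0 1) := by
    intro N
    rcases N with _ | N
    -- for `N = 0` the trivial bound suffices, since `exp 1 ≥ 1`
    · calc μ.restrict B (A 0) ≤ μ.restrict B univ := measure_mono (subset_univ _)
        _ = 1 * μ B := by simp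
        _ ≤ _ := by
          gcongr
          simp
    · have h1 := measure_lt_ballPotential_le μ hh hK0' ENNReal.ofReal_ne_top hK hI N
      have e : (1 : ℝ) - ((N + 1 : ℕ) : ℝ) = -N := by push_cast; ring
      rw [e]
      refine le_trans ?_ h1
      rw [Measure.restrict_apply₀ (hAm _)]
      refine measure_mono_ae ?_
      filter_upwards [(ae_restrict_iff' hBm).1 hDh] with x hx hxA
      refine ⟨hxA.2, lt_of_lt_of_le ?_ (hx hxA.2)⟩
      have h2 : ENNReal.ofReal K * (N + 1) = ENNReal.ofReal (K * ((N + 1 : ℕ) : ℝ)) := by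
        rw [ENNReal.ofReal_mul hK0.le, ENNReal.ofReal_natCast]; push_cast; rfl
      rw [h2]
      exact (ENNReal.ofReal_lt_ofReal_iff_of_nonneg (by positivity)).2 hxA.1
  have hpt : ∀ x, ENNReal.ofReal (Real.exp (D x / (2 * K))) ≤ 1 + ∑' N : ℕ,
      (A N).indicator (fun _ => ENNReal.ofReal (Real.exp ((N + 1) / 2))) x := by
    intro x
    rcases le_or_gt (D x) 0 with h0 | h0
    · refine le_trans ?_ le_self_add
      rw [ENNReal.ofReal_le_one, Real.exp_le_one_iff]
      exact div_nonpos_of_nonpos_of_nonneg h0 (by positivity)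
    · refine le_trans ?_ le_add_self
      obtain ⟨N, hN⟩ : ∃ N, ⌈D x / K⌉₊ = N + 1 :=
        Nat.exists_eq_add_one_of_ne_zero (Nat.ceil_pos.2 (by positivity)).ne'
      refine le_trans ?_ (ENNReal.le_tsum N)
      have h1 : (N : ℝ) < D x / K := Nat.lt_ceil.1 (by omega)
      have h2 : D x / K ≤ N + 1 := by
        have := Nat.le_ceil (D x / K); rw [hN] at this; exact_mod_cast this
      have hx : x ∈ A N := by
        rw [lt_div_iff₀ hK0] at h1
        simpa [hA, mul_comm] using h1
      rw [indicator_of_mem hx]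
      refine ENNReal.ofReal_le_ofReal (Real.exp_le_exp.2 ?_)
      rw [mul_comm, ← div_div]
      gcongr
  calc ∫⁻ x in B, ENNReal.ofReal (Real.exp (D x / (2 * K))) ∂μ
      ≤ ∫⁻ x in B, (1 + ∑' N : ℕ,
          (A N).indicator (fun _ => ENNReal.ofReal (Real.exp ((N + 1) / 2))) x) ∂μ :=
        lintegral_mono hpt
    _ = μ B + ∑' N : ℕ, ENNReal.ofReal (Real.exp ((N + 1) / 2)) * μ.restrict B (A N) := by
        rw [lintegral_add_left measurable_const, lintegral_tsum]
        · simp_rw [lintegral_indicator_const₀ (hAm _)]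
          simp
        · exact fun N => aemeasurable_const.indicator₀ (hAm N)
    _ ≤ μ (ball 0 1) + ∑' N : ℕ, μ (ball 0 1) *
          (ENNReal.ofReal (Real.exp (3 / 2)) * ENNReal.ofReal (Real.exp (-(1 / 2))) ^ N) := by
        refine add_le_add (measure_mono hB) (ENNReal.tsum_le_tsum fun N => ?_)
        refine (mul_le_mul_right (hAμ N) _).trans (le_of_eq ?_)
        rw [← mul_assoc, mul_comm, ← ENNReal.ofReal_mul (Real.exp_nonneg _), ← Real.exp_add,
          ← ENNReal.ofReal_pow (Real.exp_nonneg _), ← ENNReal.ofReal_mul (Real.exp_nonneg _),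
          ← Real.exp_nat_mul, ← Real.exp_add]
        congr 3
        ring
    _ = expConst μ := by
        rw [expConst, ENNReal.tsum_mul_left, mul_add, mul_one]

end BallPotential

/-! ### Convergence in `L²` and mollification -/

/-- Cauchy–Schwarz against the constant function `1`. -/
theorem sq_lintegral_le {α : Type*} [MeasurableSpace α] (ν : Measure α) {g : α → ℝ≥0∞}
    (hg : AEMeasurable g ν) : (∫⁻ x, g x ∂ν) ^ 2 ≤ ν univ * ∫⁻ x, g x ^ 2 ∂ν := by
  have h := ENNReal.lintegral_mul_le_Lp_mul_Lq ν Real.HolderConjugate.two_two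
    (aemeasurable_const (b := (1 : ℝ≥0∞))) hg
  simp only [Pi.mul_apply, one_mul, ENNReal.rpow_ofNat, one_pow, lintegral_one] at h
  refine (pow_le_pow_left' h 2).trans (le_of_eq ?_)
  rw [mul_pow]
  congr 1 <;> rw [← ENNReal.rpow_natCast, ← ENNReal.rpow_mul] <;> norm_num

theorem lintegral_mul_sq_le {α : Type*} [MeasurableSpace α] (ν : Measure α) {f g : α → ℝ≥0∞}
    (hf : AEMeasurable f ν) (hg : AEMeasurable g ν) :
    (∫⁻ x, f x * g x ∂ν) ^ 2 ≤ (∫⁻ x, f x ^ 2 ∂ν) * ∫⁻ x, g x ^ 2 ∂ν := by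
  have h := ENNReal.lintegral_mul_le_Lp_mul_Lq ν Real.HolderConjugate.two_two hf hg
  simp only [Pi.mul_apply, ENNReal.rpow_ofNat] at h
  refine (pow_le_pow_left' h 2).trans (le_of_eq ?_)
  rw [mul_pow]
  congr 1 <;> rw [← ENNReal.rpow_natCast, ← ENNReal.rpow_mul] <;> norm_num

theorem enorm_sq_eq (r : ℝ) : ‖r‖ₑ ^ 2 = ENNReal.ofReal (r ^ 2) := by
  rw [← ofReal_norm, ← ENNReal.ofReal_pow (norm_nonneg _), Real.norm_eq_abs, sq_abs]

theorem enorm_add_sq_le (a b : ℝ) : ‖a + b‖ₑ ^ 2 ≤ 2 * ‖a‖ₑ ^ 2 + 2 * ‖b‖ₑ ^ 2 := by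
  have h2 : (2 : ℝ≥0∞) = ENNReal.ofReal 2 := by simp
  rw [enorm_sq_eq, enorm_sq_eq, enorm_sq_eq, h2, ← ENNReal.ofReal_mul zero_le_two,
    ← ENNReal.ofReal_mul zero_le_two, ← ENNReal.ofReal_add (by positivity) (by positivity)]
  exact ENNReal.ofReal_le_ofReal (by nlinarith [sq_nonneg (a - b)])

theorem memLp_two_iff {α : Type*} [MeasurableSpace α] {ν : Measure α} {f : α → ℝ} :
    MemLp f 2 ν ↔ AEStronglyMeasurable f ν ∧ ∫⁻ x, ‖f x‖ₑ ^ 2 ∂ν < ∞ := by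
  rw [MemLp, eLpNorm_lt_top_iff_lintegral_rpow_enorm_lt_top two_ne_zero ENNReal.ofNat_ne_top]
  simp

section L2

variable {α : Type*} [MeasurableSpace α] {ν : Measure α}

/-- Almost everywhere convergence together with `‖F n‖₂ ≤ ‖f‖₂` implies convergence in `L²`: by the
parallelogram identity `‖F n - f‖₂² ≤ 4 ‖f‖₂² - ‖F n + f‖₂²`, and Fatou's lemma bounds `‖F n + f‖₂²`
from below by `4 ‖f‖₂²` in the limit. -/
theorem tendsto_lintegral_sq_of_ae_of_le {f : α → ℝ} {F : ℕ → α → ℝ}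
    (hf : MemLp f 2 ν) (hF : ∀ n, AEStronglyMeasurable (F n) ν)
    (hae : ∀ᵐ x ∂ν, Tendsto (fun n => F n x) atTop (𝓝 (f x)))
    (hle : ∀ n, ∫⁻ x, ‖F n x‖ₑ ^ 2 ∂ν ≤ ∫⁻ x, ‖f x‖ₑ ^ 2 ∂ν) :
    Tendsto (fun n => ∫⁻ x, ‖F n x - f x‖ₑ ^ 2 ∂ν) atTop (𝓝 0) := by
  have hft := (memLp_two_iff.1 hf).2
  have hfm := hf.1
  set I := ∫⁻ x, ‖f x‖ₑ ^ 2 ∂ν with hI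
  set P : ℕ → ℝ≥0∞ := fun n => ∫⁻ x, ‖F n x + f x‖ₑ ^ 2 ∂ν with hP
  have hpar : ∀ n, ∫⁻ x, ‖F n x - f x‖ₑ ^ 2 ∂ν + P n ≤ 4 * I := by
    intro n
    have hm : AEMeasurable (fun x => ‖F n x - f x‖ₑ ^ 2) ν :=
      ((hF n).sub hfm).enorm.pow_const 2
    rw [hP, ← lintegral_add_left' hm]
    calc ∫⁻ x, ‖F n x - f x‖ₑ ^ 2 + ‖F n x + f x‖ₑ ^ 2 ∂ν
        = ∫⁻ x, 2 * ‖F n x‖ₑ ^ 2 + 2 * ‖f x‖ₑ ^ 2 ∂ν := by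
          refine lintegral_congr fun x => ?_
          have h2 : (2 : ℝ≥0∞) = ENNReal.ofReal 2 := by simp
          simp only [enorm_sq_eq]
          rw [h2, ← ENNReal.ofReal_mul zero_le_two, ← ENNReal.ofReal_mul zero_le_two,
            ← ENNReal.ofReal_add (by positivity) (by positivity),
            ← ENNReal.ofReal_add (by positivity) (by positivity)]
          congr 1
          ring
      _ = 2 * ∫⁻ x, ‖F n x‖ₑ ^ 2 ∂ν + 2 * I := by
          rw [lintegral_add_left' (((hF n).enorm.pow_const 2).const_mul 2),
            lintegral_const_mul'' _ ((hF n).enorm.pow_const 2),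
            lintegral_const_mul'' _ (hfm.enorm.pow_const 2)]
      _ ≤ 2 * I + 2 * I := by gcongr; exact hle n
      _ = 4 * I := by ring
  have hfat : 4 * I ≤ liminf P atTop := by
    have h1 := lintegral_liminf_le' (μ := ν) (u := atTop)
      (f := fun n x => ‖F n x + f x‖ₑ ^ 2) fun n => ((hF n).add hfm).enorm.pow_const 2
    refine le_trans (le_of_eq ?_) h1
    rw [hI, ← lintegral_const_mul'' _ (hfm.enorm.pow_const 2)]
    refine lintegral_congr_ae ?_
    filter_upwards [hae] with x hx
    have h3 : Tendsto (fun n => ‖F n x + f x‖ₑ ^ 2) atTop (𝓝 (‖f x + f x‖ₑ ^ 2)) :=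
      (ENNReal.continuous_pow 2).continuousAt.tendsto.comp (hx.add_const _).enorm
    rw [h3.liminf_eq, enorm_sq_eq, enorm_sq_eq]
    have h4 : (4 : ℝ≥0∞) = ENNReal.ofReal 4 := by simp
    rw [h4, ← ENNReal.ofReal_mul (by norm_num)]
    congr 1
    ring
  have hIt : 4 * I ≠ ∞ := ENNReal.mul_ne_top (by simp) hft.ne
  have hPle : ∀ n, P n ≤ 4 * I := fun n => le_add_self.trans (hpar n)
  have hPt : Tendsto P atTop (𝓝 (4 * I)) :=
    tendsto_of_le_liminf_of_limsup_le hfat (limsup_le_of_le (by isBoundedDefault)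
      (Eventually.of_forall hPle))
  have hsub : Tendsto (fun n => 4 * I - P n) atTop (𝓝 0) := by
    have := ENNReal.Tendsto.sub (tendsto_const_nhds (x := 4 * I)) hPt (Or.inl hIt)
    simpa using this
  refine tendsto_of_tendsto_of_tendsto_of_le_of_le tendsto_const_nhds hsub
    (fun _ => bot_le) fun n => ?_
  exact ENNReal.le_sub_of_add_le_right (ne_top_of_le_ne_top hIt (hPle n)) (hpar n)

/-- `L²` convergence is preserved under multiplication by uniformly bounded, almost everywhere
convergent factors. -/
theorem tendsto_lintegral_sq_mul {f b : α → ℝ} {F β : ℕ → α → ℝ} {M : ℝ}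
    (hf : MemLp f 2 ν) (hFm : ∀ n, AEStronglyMeasurable (F n) ν)
    (hβm : ∀ n, AEStronglyMeasurable (β n) ν)
    (hF : Tendsto (fun n => ∫⁻ x, ‖F n x - f x‖ₑ ^ 2 ∂ν) atTop (𝓝 0))
    (hM : ∀ n, ∀ᵐ x ∂ν, |β n x| ≤ M)
    (hβ : ∀ᵐ x ∂ν, Tendsto (fun n => β n x) atTop (𝓝 (b x))) :
    Tendsto (fun n => ∫⁻ x, ‖F n x * β n x - f x * b x‖ₑ ^ 2 ∂ν) atTop (𝓝 0) := by
  have hft := (memLp_two_iff.1 hf).2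
  have hfm := hf.1
  have hbm : AEStronglyMeasurable b ν := aestronglyMeasurable_of_tendsto_ae atTop hβm hβ
  have hMb : ∀ᵐ x ∂ν, |b x| ≤ M := by
    filter_upwards [ae_all_iff.2 hM, hβ] with x h1 h2
    exact le_of_tendsto h2.abs (Eventually.of_forall h1)
  have hc : Tendsto (fun n => ∫⁻ x, ‖f x * (β n x - b x)‖ₑ ^ 2 ∂ν) atTop (𝓝 0) := by
    have h0 : (0 : ℝ≥0∞) = ∫⁻ _ : α, 0 ∂ν := by simp
    rw [h0]
    refine tendsto_lintegral_of_dominated_convergence'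
      (fun x => ENNReal.ofReal ((2 * M) ^ 2) * ‖f x‖ₑ ^ 2)
      (fun n => (hfm.mul ((hβm n).sub hbm)).enorm.pow_const 2) ?_ ?_ ?_
    · intro n
      filter_upwards [hM n, hMb] with x h1 h2
      rw [enorm_mul, mul_pow, mul_comm]
      gcongr
      rw [enorm_sq_eq]
      refine ENNReal.ofReal_le_ofReal (sq_le_sq' ?_ ?_)
      · have := abs_le.1 h1; have := abs_le.1 h2; linarith
      · have := abs_le.1 h1; have := abs_le.1 h2; linarith
    · rw [lintegral_const_mul'' _ (hfm.enorm.pow_const 2)]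
      exact ENNReal.mul_ne_top ENNReal.ofReal_ne_top hft.ne
    · filter_upwards [hβ] with x hx
      have h3 : Tendsto (fun n => ‖f x * (β n x - b x)‖ₑ ^ 2) atTop
          (𝓝 (‖f x * (b x - b x)‖ₑ ^ 2)) :=
        (ENNReal.continuous_pow 2).continuousAt.tendsto.comp
          ((hx.sub_const _).const_mul _).enorm
      simpa using h3
  have hd : Tendsto (fun n => 2 * (ENNReal.ofReal (M ^ 2) * ∫⁻ x, ‖F n x - f x‖ₑ ^ 2 ∂ν)
      + 2 * ∫⁻ x, ‖f x * (β n x - b x)‖ₑ ^ 2 ∂ν) atTop (𝓝 0) := by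
    have h1 := ENNReal.Tendsto.const_mul (a := 2)
      (ENNReal.Tendsto.const_mul (a := ENNReal.ofReal (M ^ 2)) hF (Or.inr ENNReal.ofReal_ne_top))
      (Or.inr ENNReal.ofNat_ne_top)
    have h2 := ENNReal.Tendsto.const_mul (a := 2) hc (Or.inr ENNReal.ofNat_ne_top)
    simpa using h1.add h2
  refine tendsto_of_tendsto_of_tendsto_of_le_of_le tendsto_const_nhds hd
    (fun _ => bot_le) fun n => ?_
  have hm1 : AEMeasurable (fun x => ‖F n x - f x‖ₑ ^ 2) ν := ((hFm n).sub hfm).enorm.pow_const 2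
  have hm2 : AEMeasurable (fun x => ‖f x * (β n x - b x)‖ₑ ^ 2) ν :=
    (hfm.mul ((hβm n).sub hbm)).enorm.pow_const 2
  change _ ≤ 2 * (ENNReal.ofReal (M ^ 2) * ∫⁻ x, ‖F n x - f x‖ₑ ^ 2 ∂ν)
      + 2 * ∫⁻ x, ‖f x * (β n x - b x)‖ₑ ^ 2 ∂ν
  rw [← lintegral_const_mul'' _ hm1, ← lintegral_const_mul'' _ (hm1.const_mul _),
    ← lintegral_const_mul'' _ hm2, ← lintegral_add_left' ((hm1.const_mul _).const_mul _)]
  refine lintegral_mono_ae ?_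
  filter_upwards [hM n] with x h1
  have e : F n x * β n x - f x * b x = (F n x - f x) * β n x + f x * (β n x - b x) := by ring
  rw [e]
  refine (enorm_add_sq_le _ _).trans ?_
  gcongr
  rw [enorm_mul, mul_pow, mul_comm]
  gcongr
  rw [enorm_sq_eq]
  exact ENNReal.ofReal_le_ofReal (sq_le_sq' (by linarith [abs_le.1 h1]) (abs_le.1 h1).2)

theorem tendsto_lintegral_mul_of_sq {f g : α → ℝ} {F : ℕ → α → ℝ} (hf : MemLp f 2 ν)
    (hFm : ∀ n, AEStronglyMeasurable (F n) ν) (hg : MemLp g 2 ν)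
    (hF : Tendsto (fun n => ∫⁻ x, ‖F n x - f x‖ₑ ^ 2 ∂ν) atTop (𝓝 0)) :
    Tendsto (fun n => ∫⁻ x, ‖F n x * g x - f x * g x‖ₑ ∂ν) atTop (𝓝 0) := by
  have hgt := (memLp_two_iff.1 hg).2
  have hsq : Tendsto (fun n => (∫⁻ x, ‖F n x * g x - f x * g x‖ₑ ∂ν) ^ 2) atTop (𝓝 0) := by
    have h1 := ENNReal.Tendsto.mul_const (b := ∫⁻ x, ‖g x‖ₑ ^ 2 ∂ν) hF (Or.inr hgt.ne)
    rw [zero_mul] at h1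
    refine tendsto_of_tendsto_of_tendsto_of_le_of_le tendsto_const_nhds h1
      (fun _ => bot_le) fun n => ?_
    refine le_trans (le_of_eq ?_)
      (lintegral_mul_sq_le ν ((hFm n).sub hf.1).enorm hg.1.enorm)
    congr 1
    refine lintegral_congr fun x => ?_
    rw [← sub_mul, enorm_mul]
  have h2 := (ENNReal.continuous_rpow_const (y := 1 / 2)).continuousAt.tendsto.comp hsq
  simp only [Function.comp_def] at h2
  rw [ENNReal.zero_rpow_of_pos (by norm_num)] at h2
  refine h2.congr fun n => ?_
  rw [← ENNReal.rpow_natCast, ← ENNReal.rpow_mul]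
  norm_num

theorem tendsto_integral_mul_of_sq {f g : α → ℝ} {F : ℕ → α → ℝ} (hf : MemLp f 2 ν)
    (hFm : ∀ n, MemLp (F n) 2 ν) (hg : MemLp g 2 ν)
    (hF : Tendsto (fun n => ∫⁻ x, ‖F n x - f x‖ₑ ^ 2 ∂ν) atTop (𝓝 0)) :
    Tendsto (fun n => ∫ x, F n x * g x ∂ν) atTop (𝓝 (∫ x, f x * g x ∂ν)) :=
  tendsto_integral_of_L1 _ (hf.integrable_mul hg).1
    (Eventually.of_forall fun n => (hFm n).integrable_mul hg)
    (tendsto_lintegral_mul_of_sq hf (fun n => (hFm n).1) hg hF)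

end L2

section Mollify

open scoped Convolution ContDiff

variable {E : Type*} [NormedAddCommGroup E] [NormedSpace ℝ E] [FiniteDimensional ℝ E]
  [MeasurableSpace E] [BorelSpace E] [HasContDiffBump E] (μ : Measure E) [μ.IsAddHaarMeasure]

/-- Bump functions at the origin with inner radius `1 / (2 (n + 1))` and outer radius `1 / (n + 1)`.
The bounded ratio of the radii is what Lebesgue differentiation requires. -/
noncomputable def shrinkingBump (n : ℕ) : ContDiffBump (0 : E) where
  rIn := 1 / (2 * (n + 1))
  rOut := 1 / (n + 1)
  rIn_pos := by positivity
  rIn_lt_rOut := one_div_lt_one_div_of_lt (by positivity) (by linarith [n.cast_nonneg (α := ℝ)])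

/-- The convolution of `f` with the normalised `n`-th bump function. -/
noncomputable def mollify (n : ℕ) (f : E → ℝ) : E → ℝ :=
  (shrinkingBump n).normed μ ⋆[ContinuousLinearMap.lsmul ℝ ℝ, μ] f

omit [FiniteDimensional ℝ E] [BorelSpace E] [μ.IsAddHaarMeasure] in
theorem mollify_eq_integral (n : ℕ) (f : E → ℝ) (x : E) :
    mollify μ n f x = ∫ t, (shrinkingBump n).normed μ t * f (x - t) ∂μ := rfl

omit [NormedSpace ℝ E] [FiniteDimensional ℝ E] [MeasurableSpace E] [BorelSpace E]
  [HasContDiffBump E] in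
theorem tendsto_rOut_shrinkingBump :
    Tendsto (fun n => (shrinkingBump (E := E) n).rOut) atTop (𝓝 0) :=
  tendsto_one_div_add_atTop_nhds_zero_nat

variable {f : E → ℝ}

theorem ae_tendsto_mollify (hf : LocallyIntegrable f μ) :
    ∀ᵐ x ∂μ, Tendsto (fun n => mollify μ n f x) atTop (𝓝 (f x)) := by
  refine ContDiffBump.ae_convolution_tendsto_right_of_locallyIntegrable (K := 2)
    tendsto_rOut_shrinkingBump (Eventually.of_forall fun n => le_of_eq ?_) hf
  simp only [shrinkingBump]
  field_simp

theorem contDiff_mollify (hf : LocallyIntegrable f μ) (n : ℕ) :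
    ContDiff ℝ ∞ (mollify μ n f) :=
  (shrinkingBump n).hasCompactSupport_normed.contDiff_convolution_left _
    (shrinkingBump n).contDiff_normed hf

theorem mollify_nonneg (hf : ∀ᵐ x ∂μ, 0 ≤ f x) (n : ℕ) (x : E) : 0 ≤ mollify μ n f x := by
  refine integral_nonneg_of_ae ?_
  filter_upwards [(quasiMeasurePreserving_sub_left μ x).ae hf] with t ht
  exact mul_nonneg ((shrinkingBump n).nonneg_normed t) ht

theorem lintegral_ofReal_normed (n : ℕ) :
    ∫⁻ t, ENNReal.ofReal ((shrinkingBump n).normed μ t) ∂μ = 1 := by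
  rw [← ofReal_integral_eq_lintegral_ofReal (shrinkingBump n).integrable_normed
    (ae_of_all _ (shrinkingBump n).nonneg_normed), (shrinkingBump n).integral_normed,
    ENNReal.ofReal_one]

/-- Jensen's inequality for the probability density of the mollifier. -/
theorem enorm_mollify_sq_le (hf : AEMeasurable f μ) (n : ℕ) (x : E) :
    ‖mollify μ n f x‖ₑ ^ 2
      ≤ ∫⁻ t, ENNReal.ofReal ((shrinkingBump n).normed μ t) * ‖f (x - t)‖ₑ ^ 2 ∂μ := by
  set ρ : E → ℝ := (shrinkingBump n).normed μ with hρ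
  have hρm : Measurable fun t => ENNReal.ofReal (ρ t) :=
    (shrinkingBump n).continuous_normed.measurable.ennreal_ofReal
  have hfm : AEMeasurable (fun t => f (x - t)) μ :=
    hf.comp_quasiMeasurePreserving (quasiMeasurePreserving_sub_left μ x)
  have hfm' : AEMeasurable (fun t => ‖f (x - t)‖ₑ)
      (μ.withDensity fun t => ENNReal.ofReal (ρ t)) :=
    hfm.enorm.mono_ac (withDensity_absolutelyContinuous _ _)
  have h1 : ‖mollify μ n f x‖ₑ
      ≤ ∫⁻ t, ‖f (x - t)‖ₑ ∂(μ.withDensity fun t => ENNReal.ofReal (ρ t)) := by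
    rw [lintegral_withDensity_eq_lintegral_mul₀ hρm.aemeasurable hfm.enorm, mollify_eq_integral]
    refine (enorm_integral_le_lintegral_enorm _).trans (le_of_eq ?_)
    refine lintegral_congr fun t => ?_
    rw [enorm_mul, Real.enorm_of_nonneg ((shrinkingBump n).nonneg_normed t)]
    rfl
  refine (pow_le_pow_left' h1 2).trans ((sq_lintegral_le _ hfm').trans (le_of_eq ?_))
  rw [withDensity_apply _ MeasurableSet.univ, setLIntegral_univ, lintegral_ofReal_normed,
    one_mul, lintegral_withDensity_eq_lintegral_mul₀ hρm.aemeasurable (hfm.enorm.pow_const 2)]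
  rfl

theorem lintegral_enorm_mollify_sq_le (hf : AEMeasurable f μ) (n : ℕ) :
    ∫⁻ x, ‖mollify μ n f x‖ₑ ^ 2 ∂μ ≤ ∫⁻ x, ‖f x‖ₑ ^ 2 ∂μ := by
  refine (lintegral_mono (enorm_mollify_sq_le μ hf n)).trans (le_of_eq ?_)
  have hρm : Measurable fun t => ENNReal.ofReal ((shrinkingBump (E := E) n).normed μ t) :=
    (shrinkingBump n).continuous_normed.measurable.ennreal_ofReal
  have hq : Measure.QuasiMeasurePreserving (fun p : E × E => p.1 - p.2) (μ.prod μ) μ :=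
    quasiMeasurePreserving_sub μ μ
  have hm : AEMeasurable (Function.uncurry fun x t =>
      ENNReal.ofReal ((shrinkingBump n).normed μ t) * ‖f (x - t)‖ₑ ^ 2) (μ.prod μ) :=
    (hρm.comp measurable_snd).aemeasurable.mul
      ((hf.comp_quasiMeasurePreserving hq).enorm.pow_const 2)
  rw [lintegral_lintegral_swap hm]
  have e : ∀ t, ∫⁻ x, ENNReal.ofReal ((shrinkingBump n).normed μ t) * ‖f (x - t)‖ₑ ^ 2 ∂μ
      = ENNReal.ofReal ((shrinkingBump n).normed μ t) * ∫⁻ x, ‖f x‖ₑ ^ 2 ∂μ := by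
    intro t
    rw [lintegral_const_mul' _ _ ENNReal.ofReal_ne_top,
      lintegral_sub_right_eq_self (fun x => ‖f x‖ₑ ^ 2) t]
  simp_rw [e]
  rw [lintegral_mul_const _ hρm, lintegral_ofReal_normed, one_mul]

theorem tendsto_lintegral_sq_mollify (hf : MemLp f 2 μ) :
    Tendsto (fun n => ∫⁻ x, ‖mollify μ n f x - f x‖ₑ ^ 2 ∂μ) atTop (𝓝 0) := by
  have hloc : LocallyIntegrable f μ := hf.locallyIntegrable one_le_two
  exact tendsto_lintegral_sq_of_ae_of_le hf
    (fun n => (contDiff_mollify μ hloc n).continuous.aestronglyMeasurable)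
    (ae_tendsto_mollify μ hloc) (lintegral_enorm_mollify_sq_le μ hf.1.aemeasurable)

theorem memLp_mollify (hf : MemLp f 2 μ) (n : ℕ) : MemLp (mollify μ n f) 2 μ :=
  memLp_two_iff.2 ⟨(contDiff_mollify μ (hf.locallyIntegrable one_le_two)
      n).continuous.aestronglyMeasurable,
    (lintegral_enorm_mollify_sq_le μ hf.1.aemeasurable n).trans_lt (memLp_two_iff.1 hf).2⟩

end Mollify

open scoped Convolution ContDiff in
/-- Mollification commutes with weak differentiation at points whose distance to the complement of
`Ω` exceeds the mollification radius. Functions on `Ω` are extended by zero. -/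
theorem fderiv_mollify_apply_single {d : ℕ} {Ω : Opens (EuclideanSpace ℝ (Fin d))} {i : Fin d}
    {f g : EuclideanSpace ℝ (Fin d) → ℝ} (hfg : IsWeakPartialDeriv Ω i f g)
    (hf : LocallyIntegrable ((Ω : Set (EuclideanSpace ℝ (Fin d))).indicator f)) {n : ℕ}
    {x : EuclideanSpace ℝ (Fin d)} (hx : closedBall x (1 / (n + 1)) ⊆ Ω) :
    fderiv ℝ (mollify volume n ((Ω : Set (EuclideanSpace ℝ (Fin d))).indicator f)) x
        (EuclideanSpace.single i 1)
      = mollify volume n ((Ω : Set (EuclideanSpace ℝ (Fin d))).indicator g) x := by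
  set ρ : EuclideanSpace ℝ (Fin d) → ℝ := (shrinkingBump n).normed volume with hρ
  have hρc : HasCompactSupport ρ := (shrinkingBump n).hasCompactSupport_normed
  have hρs : ContDiff ℝ ∞ ρ := (shrinkingBump n).contDiff_normed
  have hm : MeasurableSet (Ω : Set (EuclideanSpace ℝ (Fin d))) := Ω.isOpen.measurableSet
  have h1 := hρc.hasFDerivAt_convolution_left (ContinuousLinearMap.lsmul ℝ ℝ)
    (hρs.of_le (by exact_mod_cast le_top)) hf x (μ := volume)
  have hex := (hρc.fderiv (𝕜 := ℝ)).convolutionExists_left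
    ((ContinuousLinearMap.lsmul ℝ ℝ : ℝ →L[ℝ] ℝ →L[ℝ] ℝ).precompL (EuclideanSpace ℝ (Fin d)))
    (hρs.continuous_fderiv (by simp)) hf x (μ := volume)
  have h2 : fderiv ℝ (mollify volume n ((Ω : Set (EuclideanSpace ℝ (Fin d))).indicator f)) x
        (EuclideanSpace.single i 1)
      = ∫ t, fderiv ℝ ρ t (EuclideanSpace.single i 1) *
        (Ω : Set (EuclideanSpace ℝ (Fin d))).indicator f (x - t) := by
    have : fderiv ℝ (mollify volume n ((Ω : Set (EuclideanSpace ℝ (Fin d))).indicator f)) x = _ :=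
      h1.fderiv
    rw [this, convolution_def, ContinuousLinearMap.integral_apply hex]
    rfl
  let φ : 𝓓(Ω, ℝ) := ⟨fun t => ρ (x - t), hρs.comp (contDiff_const.sub contDiff_id),
    hρc.comp_homeomorph (Homeomorph.subLeft x), by
      have e : tsupport (fun t => ρ (x - t)) = (Homeomorph.subLeft x) ⁻¹' tsupport ρ :=
        tsupport_comp_eq_preimage ρ (Homeomorph.subLeft x)
      rw [e, hρ, (shrinkingBump n).tsupport_normed_eq]
      refine fun t ht => hx ?_
      simpa [dist_eq_norm, norm_sub_rev, shrinkingBump] using ht⟩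
  have hφ : ∀ t, φ t = ρ (x - t) := fun t => rfl
  have hdφ : ∀ t, fderiv ℝ φ t (EuclideanSpace.single i 1)
      = - fderiv ℝ ρ (x - t) (EuclideanSpace.single i 1) := by
    intro t
    have h3 : HasFDerivAt (fun t => ρ (x - t))
        ((fderiv ℝ ρ (x - t)).comp (-ContinuousLinearMap.id ℝ _)) t :=
      (hρs.differentiable (by simp) (x - t)).hasFDerivAt.comp t
        ((hasFDerivAt_id t).const_sub x)
    have h4 : fderiv ℝ φ t = _ := h3.fderiv
    rw [h4]
    simp
  have h5 := hfg.2.2 φ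
  simp_rw [hdφ, hφ, mul_neg, integral_neg, neg_inj] at h5
  have e1 : ∫ t, fderiv ℝ ρ t (EuclideanSpace.single i 1) *
        (Ω : Set (EuclideanSpace ℝ (Fin d))).indicator f (x - t)
      = ∫ t in Ω, f t * fderiv ℝ ρ (x - t) (EuclideanSpace.single i 1) := by
    rw [← integral_sub_left_eq_self _ volume x, ← integral_indicator hm]
    refine integral_congr_ae (ae_of_all _ fun t => ?_)
    by_cases ht : t ∈ (Ω : Set (EuclideanSpace ℝ (Fin d))) <;> simp [ht, mul_comm]
  have e2 : ∫ t, ρ t * (Ω : Set (EuclideanSpace ℝ (Fin d))).indicator g (x - t)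
      = ∫ t in Ω, g t * ρ (x - t) := by
    rw [← integral_sub_left_eq_self _ volume x, ← integral_indicator hm]
    refine integral_congr_ae (ae_of_all _ fun t => ?_)
    by_cases ht : t ∈ (Ω : Set (EuclideanSpace ℝ (Fin d))) <;> simp [ht, mul_comm]
  rw [h2, mollify_eq_integral, e1, e2, h5]

/-! ### The logarithmic energy estimate -/

section Sobolev

variable {d : ℕ} {Ω : Opens (EuclideanSpace ℝ (Fin d))} {u : EuclideanSpace ℝ (Fin d) → ℝ}

theorem MemW1.isWeakPartialDeriv {p : ℝ≥0∞} (hu : MemW1 Ω p u) (i : Fin d) :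
    IsWeakPartialDeriv Ω i u fun x => weakGrad Ω u x i := by
  obtain ⟨g, hg, -⟩ := hu.2 i
  have h : ∃ g, IsWeakPartialDeriv Ω i u g := ⟨g, hg⟩
  have e : (fun x => weakGrad Ω u x i) = h.choose := by
    funext x
    simp only [weakGrad, dif_pos h]
  rw [e]
  exact h.choose_spec

theorem MemW1.memLp_weakGrad {p : ℝ≥0∞} (hu : MemW1 Ω p u) (i : Fin d) :
    MemLp (fun x => weakGrad Ω u x i) p (volume.restrict Ω) := by
  obtain ⟨g, hg, hgp⟩ := hu.2 i
  exact hgp.ae_eq (weakGrad_ae_eq hg).symm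

/-- The classical partial derivatives of a test function are its weak ones. -/
theorem isWeakPartialDeriv_testFunction (ψ : 𝓓(Ω, ℝ)) (i : Fin d) :
    IsWeakPartialDeriv Ω i ψ fun x => fderiv ℝ ψ x (EuclideanSpace.single i 1) := by
  have hc : ∀ φ : 𝓓(Ω, ℝ),
      Continuous fun x => fderiv ℝ φ x (EuclideanSpace.single i 1) := fun φ =>
    (φ.contDiff.continuous_fderiv (by simp)).clm_apply continuous_const
  refine ⟨ψ.continuous.locallyIntegrable.locallyIntegrableOn _,
    (hc ψ).locallyIntegrable.locallyIntegrableOn _, fun φ => ?_⟩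
  have h0 : ∀ x, x ∉ (Ω : Set (EuclideanSpace ℝ (Fin d))) → φ x = 0 := fun x hx =>
    image_eq_zero_of_notMem_tsupport fun h => hx (φ.tsupport_subset h)
  have h0' : ∀ x, x ∉ (Ω : Set (EuclideanSpace ℝ (Fin d))) →
      fderiv ℝ φ x (EuclideanSpace.single i 1) = 0 := fun x hx => by
    rw [image_eq_zero_of_notMem_tsupport fun h =>
      hx (φ.tsupport_subset (tsupport_fderiv_subset ℝ h))]
    rfl
  rw [setIntegral_eq_integral_of_forall_compl_eq_zero (fun x hx => by rw [h0' x hx, mul_zero]),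
    setIntegral_eq_integral_of_forall_compl_eq_zero (fun x hx => by rw [h0 x hx, mul_zero])]
  have hφd : HasCompactSupport fun x => fderiv ℝ φ x (EuclideanSpace.single i 1) :=
    φ.hasCompactSupport.fderiv_apply ℝ _
  refine integral_mul_fderiv_eq_neg_fderiv_mul_of_integrable ?_ ?_ ?_
    (fun x _ => ψ.contDiff.differentiable (by simp) x)
    (fun x _ => φ.contDiff.differentiable (by simp) x)
  · exact ((hc ψ).mul φ.continuous).integrable_of_hasCompactSupport φ.hasCompactSupport.mul_left
  · exact (ψ.continuous.mul (hc φ)).integrable_of_hasCompactSupport hφd.mul_left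
  · exact (ψ.continuous.mul φ.continuous).integrable_of_hasCompactSupport
      φ.hasCompactSupport.mul_left

theorem memW012_testFunction (ψ : 𝓓(Ω, ℝ)) : MemW012 Ω ψ := by
  have hc : ∀ i, Continuous fun x => fderiv ℝ ψ x (EuclideanSpace.single i 1) := fun i =>
    (ψ.contDiff.continuous_fderiv (by simp)).clm_apply continuous_const
  refine ⟨⟨?_, fun i => ⟨_, isWeakPartialDeriv_testFunction ψ i, ?_⟩⟩, fun ε _ => ⟨ψ, ?_, ?_⟩⟩
  · exact (ψ.continuous.memLp_of_hasCompactSupport ψ.hasCompactSupport).restrict _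
  · exact ((hc i).memLp_of_hasCompactSupport (ψ.hasCompactSupport.fderiv_apply ℝ _)).restrict _
  · simp
  · intro i
    rw [eLpNorm_congr_ae (g := fun _ => 0)]
    · simp
    · filter_upwards [weakGrad_ae_eq (isWeakPartialDeriv_testFunction ψ i)] with x hx
      rw [hx, sub_self]

theorem memLp_indicator {p : ℝ≥0∞} {f : EuclideanSpace ℝ (Fin d) → ℝ}
    (hf : MemLp f p (volume.restrict Ω)) :
    MemLp ((Ω : Set (EuclideanSpace ℝ (Fin d))).indicator f) p :=
  (memLp_indicator_iff_restrict Ω.isOpen.measurableSet).2 hf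

theorem ae_restrict_tendsto_mollify {f : EuclideanSpace ℝ (Fin d) → ℝ}
    (hf : MemLp f 2 (volume.restrict Ω)) :
    ∀ᵐ x ∂volume.restrict (Ω : Set (EuclideanSpace ℝ (Fin d))), Tendsto (fun n =>
      mollify volume n ((Ω : Set (EuclideanSpace ℝ (Fin d))).indicator f) x) atTop (𝓝 (f x)) := by
  rw [ae_restrict_iff' Ω.isOpen.measurableSet]
  filter_upwards [ae_tendsto_mollify volume
    ((memLp_indicator hf).locallyIntegrable one_le_two)] with x hx hxΩ
  rwa [indicator_of_mem hxΩ] at hx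

theorem tendsto_setLIntegral_sq_mollify {f : EuclideanSpace ℝ (Fin d) → ℝ}
    (hf : MemLp f 2 (volume.restrict Ω)) :
    Tendsto (fun n => ∫⁻ x in Ω, ‖mollify volume n
      ((Ω : Set (EuclideanSpace ℝ (Fin d))).indicator f) x - f x‖ₑ ^ 2) atTop (𝓝 0) := by
  refine tendsto_of_tendsto_of_tendsto_of_le_of_le tendsto_const_nhds
    (tendsto_lintegral_sq_mollify volume (memLp_indicator hf)) (fun _ => bot_le) fun n => ?_
  refine le_trans (le_of_eq (setLIntegral_congr_fun Ω.isOpen.measurableSet fun x hx => ?_))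
    (setLIntegral_le_lintegral (Ω : Set (EuclideanSpace ℝ (Fin d))) _)
  simp only [indicator_of_mem hx]

theorem mollify_indicator_nonneg
    (hu : ∀ᵐ x ∂volume.restrict (Ω : Set (EuclideanSpace ℝ (Fin d))), 0 < u x) (n : ℕ)
    (x : EuclideanSpace ℝ (Fin d)) :
    0 ≤ mollify volume n ((Ω : Set (EuclideanSpace ℝ (Fin d))).indicator u) x := by
  refine mollify_nonneg volume ?_ n x
  filter_upwards [(ae_restrict_iff' Ω.isOpen.measurableSet).1 hu] with y hy
  exact indicator_apply_nonneg fun h => (hy h).le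

end Sobolev

theorem memLp_mul_of_bound {α : Type*} [MeasurableSpace α] {ν : Measure α} {f b : α → ℝ} {M : ℝ}
    (hf : MemLp f 2 ν) (hb : AEStronglyMeasurable b ν) (hM : ∀ᵐ x ∂ν, |b x| ≤ M) :
    MemLp (fun x => f x * b x) 2 ν := by
  refine hf.of_le_mul (c := M) (hf.1.mul hb) ?_
  filter_upwards [hM] with x hx
  rw [norm_mul, mul_comm, Real.norm_eq_abs (b x)]
  gcongr

section Coeff

variable {d : ℕ} {A : Matrix (Fin d) (Fin d) ℝ} {Lam : ℝ}

/-- The bound on the inverse matrix, tested with `ξ = A p`. Coercivity makes `A` invertible, so that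
`A⁻¹` is the true inverse. -/
theorem mulVec_dotProduct_self_le (hLam : 0 < Lam)
    (h1 : ∀ ξ : Fin d → ℝ, 1 * (ξ ⬝ᵥ ξ) ≤ ξ ⬝ᵥ (A *ᵥ ξ))
    (h2 : ∀ ξ : Fin d → ℝ, Lam⁻¹ * (ξ ⬝ᵥ ξ) ≤ ξ ⬝ᵥ (A⁻¹ *ᵥ ξ)) (p : Fin d → ℝ) :
    (A *ᵥ p) ⬝ᵥ (A *ᵥ p) ≤ Lam * (p ⬝ᵥ (A *ᵥ p)) := by
  have hu : IsUnit A := by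
    rw [← Matrix.mulVec_injective_iff_isUnit]
    refine (injective_iff_map_eq_zero A.mulVecLin).2 fun ξ hξ => ?_
    have h3 := h1 ξ
    rw [Matrix.mulVecLin_apply] at hξ
    rw [hξ, dotProduct_zero, one_mul] at h3
    exact dotProduct_self_eq_zero.1 (le_antisymm h3 (dotProduct_self_star_nonneg ξ))
  have h3 := h2 (A *ᵥ p)
  rw [Matrix.mulVec_mulVec, Matrix.nonsing_inv_mul _ ((Matrix.isUnit_iff_isUnit_det A).1 hu),
    Matrix.one_mulVec, dotProduct_comm _ p, inv_mul_le_iff₀ hLam] at h3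
  exact h3

theorem mulVec_apply_sq_le {p : Fin d → ℝ}
    (h : (A *ᵥ p) ⬝ᵥ (A *ᵥ p) ≤ Lam * (p ⬝ᵥ (A *ᵥ p))) (i : Fin d) :
    (A *ᵥ p) i ^ 2 ≤ Lam ^ 2 * ∑ j, p j ^ 2 := by
  set q := A *ᵥ p
  simp only [dotProduct] at h
  have h1 : q i ^ 2 ≤ ∑ j, q j ^ 2 :=
    Finset.single_le_sum (f := fun j => q j ^ 2) (fun j _ => sq_nonneg _) (Finset.mem_univ i)
  have h2 : 2 * (Lam * ∑ j, p j * q j) ≤ ∑ j, (Lam ^ 2 * p j ^ 2 + q j ^ 2) := by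
    rw [Finset.mul_sum, Finset.mul_sum]
    exact Finset.sum_le_sum fun j _ => by nlinarith [sq_nonneg (Lam * p j - q j)]
  rw [Finset.sum_add_distrib, ← Finset.mul_sum] at h2
  simp only [← sq] at h
  linarith

/-- Young's inequality in the form used to absorb the cross term of the energy estimate. Only
`|A p|² ≤ Λ p · A p` is used, which is why `Λ` enters to the first power. -/
theorem two_mul_dotProduct_le (hLam : 0 < Lam) {p : Fin d → ℝ}
    (h : (A *ᵥ p) ⬝ᵥ (A *ᵥ p) ≤ Lam * (p ⬝ᵥ (A *ᵥ p))) (g : Fin d → ℝ) (t : ℝ) :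
    ∑ i, 2 * t * g i * (A *ᵥ p) i
      ≤ 2⁻¹ * (t ^ 2 * ∑ i, p i * (A *ᵥ p) i) + 2 * Lam * ∑ i, g i ^ 2 := by
  set q := A *ᵥ p
  simp only [dotProduct, ← sq] at h
  have h1 : ∑ i, 2 * t * g i * q i
      ≤ ∑ i, (2 * Lam * g i ^ 2 + t ^ 2 * (2 * Lam)⁻¹ * q i ^ 2) := by
    refine Finset.sum_le_sum fun i _ => ?_
    have h3 : 2 * Lam * g i ^ 2 + t ^ 2 * (2 * Lam)⁻¹ * q i ^ 2 - 2 * t * g i * q i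
        = (2 * Lam)⁻¹ * (2 * Lam * g i - t * q i) ^ 2 := by
      field_simp
      ring
    have h4 : 0 ≤ (2 * Lam)⁻¹ * (2 * Lam * g i - t * q i) ^ 2 := by positivity
    linarith
  rw [Finset.sum_add_distrib, ← Finset.mul_sum, ← Finset.mul_sum] at h1
  have h2 : t ^ 2 * (2 * Lam)⁻¹ * ∑ i, q i ^ 2 ≤ t ^ 2 * (2 * Lam)⁻¹ * (Lam * ∑ i, p i * q i) :=
    mul_le_mul_of_nonneg_left h (by positivity)
  have h5 : t ^ 2 * (2 * Lam)⁻¹ * (Lam * ∑ i, p i * q i) = 2⁻¹ * (t ^ 2 * ∑ i, p i * q i) := by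
    field_simp
  linarith

end Coeff

section Caccioppoli

variable {d : ℕ} {Ω : Opens (EuclideanSpace ℝ (Fin d))} {Lam : ℝ}
  {a : EuclideanSpace ℝ (Fin d) → Matrix (Fin d) (Fin d) ℝ} {u : EuclideanSpace ℝ (Fin d) → ℝ}

theorem IsEllipticCoeff.ae_mulVec_dotProduct_self_le (ha : IsEllipticCoeff Ω 1 Lam a) :
    ∀ᵐ x ∂volume.restrict (Ω : Set (EuclideanSpace ℝ (Fin d))), ∀ p : Fin d → ℝ,
      (a x *ᵥ p) ⬝ᵥ (a x *ᵥ p) ≤ Lam * (p ⬝ᵥ (a x *ᵥ p)) := by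
  filter_upwards [ha.coercive, ha.coercive_inv] with x h1 h2 p
  exact mulVec_dotProduct_self_le (one_pos.trans_le ha.lam_le) h1 h2 p

theorem memLp_mulVec_weakGrad (ha : IsEllipticCoeff Ω 1 Lam a) (hu : MemW1 Ω 2 u) (i : Fin d) :
    MemLp (fun x => (a x *ᵥ weakGrad Ω u x) i) 2 (volume.restrict Ω) := by
  have hm : AEStronglyMeasurable (fun x => (a x *ᵥ weakGrad Ω u x) i) (volume.restrict Ω) := by
    simp only [Matrix.mulVec, dotProduct]
    exact Finset.aestronglyMeasurable_fun_sum _ fun j _ =>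
      (ha.measurable i j).aestronglyMeasurable.mul (hu.memLp_weakGrad j).1
  refine (memLp_two_iff_integrable_sq hm).2 ?_
  have hI : Integrable (fun x => Lam ^ 2 * ∑ j, weakGrad Ω u x j ^ 2) (volume.restrict Ω) :=
    (integrable_finsetSum _ fun j _ => (hu.memLp_weakGrad j).integrable_sq).const_mul _
  refine hI.mono' (hm.pow 2) ?_
  filter_upwards [ha.ae_mulVec_dotProduct_self_le] with x hx
  rw [Real.norm_of_nonneg (sq_nonneg _)]
  exact mulVec_apply_sq_le (hx _) i

theorem fderiv_sq_div_apply {η w : EuclideanSpace ℝ (Fin d) → ℝ} {x : EuclideanSpace ℝ (Fin d)}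
    (hη : DifferentiableAt ℝ η x) (hw : DifferentiableAt ℝ w x) {ε : ℝ} (h0 : w x + ε ≠ 0)
    (e : EuclideanSpace ℝ (Fin d)) :
    fderiv ℝ (fun y => η y ^ 2 / (w y + ε)) x e
      = 2 * η x * fderiv ℝ η x e * (1 / (w x + ε))
        - fderiv ℝ w x e * (η x ^ 2 / (w x + ε) ^ 2) := by
  have h := (hη.hasFDerivAt.pow 2).mul
    ((hasDerivAt_inv h0).comp_hasFDerivAt x (hw.hasFDerivAt.add_const ε))
  rw [show fderiv ℝ (fun y => η y ^ 2 / (w y + ε)) x = _ from h.fderiv]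
  simp
  field_simp
  ring

/-- The logarithmic energy estimate `∫ η² |∇ log (u + ε)|² ≤ 4 Λ ∫ |∇η|²` for positive
supersolutions. The natural test function is `η² / (u + ε)`; here `u` is replaced in it by its
mollifications, which gives genuine smooth test functions, and the mollification parameter tends to
zero afterwards. -/
theorem lintegral_sq_mul_log_grad_le (ha : IsEllipticCoeff Ω 1 Lam a)
    (hu : IsWeakSupersolution Ω a u)
    (hpos : ∀ᵐ x ∂volume.restrict (Ω : Set (EuclideanSpace ℝ (Fin d))), 0 < u x)
    {ε : ℝ} (hε : 0 < ε) (η : 𝓓(Ω, ℝ)) :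
    ∫⁻ x in Ω, ENNReal.ofReal (η x ^ 2 / (u x + ε) ^ 2 * ∑ i, weakGrad Ω u x i ^ 2)
      ≤ ENNReal.ofReal (4 * Lam *
        ∫ x in Ω, ∑ i, fderiv ℝ η x (EuclideanSpace.single i 1) ^ 2) := by
  have hLam : 0 < Lam := one_pos.trans_le ha.lam_le
  set ν : Measure (EuclideanSpace ℝ (Fin d)) :=
    volume.restrict (Ω : Set (EuclideanSpace ℝ (Fin d))) with hν
  set p : Fin d → EuclideanSpace ℝ (Fin d) → ℝ := fun i x => weakGrad Ω u x i with hp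
  set q : Fin d → EuclideanSpace ℝ (Fin d) → ℝ := fun i x => (a x *ᵥ weakGrad Ω u x) i with hq
  set g : Fin d → EuclideanSpace ℝ (Fin d) → ℝ :=
    fun i x => fderiv ℝ η x (EuclideanSpace.single i 1) with hg
  set w : ℕ → EuclideanSpace ℝ (Fin d) → ℝ := fun n =>
    mollify volume n ((Ω : Set (EuclideanSpace ℝ (Fin d))).indicator u) with hw
  set r : ℕ → Fin d → EuclideanSpace ℝ (Fin d) → ℝ := fun n i =>
    mollify volume n ((Ω : Set (EuclideanSpace ℝ (Fin d))).indicator (p i)) with hr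
  have hp2 : ∀ i, MemLp (p i) 2 ν := hu.1.memLp_weakGrad
  have hq2 : ∀ i, MemLp (q i) 2 ν := memLp_mulVec_weakGrad ha hu.1
  have hgc : ∀ i, Continuous (g i) := fun i =>
    (η.contDiff.continuous_fderiv (by simp)).clm_apply continuous_const
  have hgs : ∀ i, HasCompactSupport (g i) := fun i => η.hasCompactSupport.fderiv_apply ℝ _
  have hg2 : ∀ i, MemLp (g i) 2 ν := fun i =>
    ((hgc i).memLp_of_hasCompactSupport (hgs i)).restrict _
  have hηg2 : ∀ i, MemLp (fun x => 2 * η x * g i x) 2 ν := fun i =>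
    (((continuous_const.mul η.continuous).mul (hgc i)).memLp_of_hasCompactSupport
      (hgs i).mul_left).restrict _
  have hloc : LocallyIntegrable ((Ω : Set (EuclideanSpace ℝ (Fin d))).indicator u) :=
    (memLp_indicator hu.1.1).locallyIntegrable one_le_two
  have hws : ∀ n, ContDiff ℝ (⊤ : ℕ∞) (w n) := contDiff_mollify volume hloc
  have hw0 : ∀ n x, 0 ≤ w n x := mollify_indicator_nonneg hpos
  have hwε : ∀ n x, 0 < w n x + ε := fun n x => by linarith [hw0 n x]
  have hwt : ∀ᵐ x ∂ν, Tendsto (fun n => w n x) atTop (𝓝 (u x)) := ae_restrict_tendsto_mollify hu.1.1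
  have hr2 : ∀ n i, MemLp (r n i) 2 ν := fun n i =>
    (memLp_mollify volume (memLp_indicator (hp2 i)) n).restrict _
  have hrt : ∀ i, Tendsto (fun n => ∫⁻ x, ‖r n i x - p i x‖ₑ ^ 2 ∂ν) atTop (𝓝 0) := fun i =>
    tendsto_setLIntegral_sq_mollify (hp2 i)
  obtain ⟨M, hM⟩ := η.continuous.bounded_above_of_compact_support η.hasCompactSupport
  simp only [Real.norm_eq_abs] at hM
  -- the multipliers `1 / (w n + ε)` and `η² / (w n + ε)²` are bounded uniformly in `n` as `w n ≥ 0`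
  have hβm : ∀ n, Continuous fun x => 1 / (w n x + ε) := fun n =>
    continuous_const.div ((hws n).continuous.add continuous_const) fun x => (hwε n x).ne'
  have hβb : ∀ n x, |1 / (w n x + ε)| ≤ 1 / ε := fun n x => by
    rw [abs_of_pos (one_div_pos.2 (hwε n x))]
    exact one_div_le_one_div_of_le hε (by linarith [hw0 n x])
  have hβt : ∀ᵐ x ∂ν, Tendsto (fun n => 1 / (w n x + ε)) atTop (𝓝 (1 / (u x + ε))) := by
    filter_upwards [hwt, hpos] with x h1 h2
    exact tendsto_const_nhds.div (h1.add_const _) (by linarith)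
  have hγm : ∀ n, Continuous fun x => η x ^ 2 / (w n x + ε) ^ 2 := fun n =>
    (η.continuous.pow 2).div (((hws n).continuous.add continuous_const).pow 2)
      fun x => (pow_pos (hwε n x) 2).ne'
  have hγb : ∀ n x, |η x ^ 2 / (w n x + ε) ^ 2| ≤ M ^ 2 / ε ^ 2 := fun n x => by
    rw [abs_of_nonneg (by positivity), ← sq_abs (η x)]
    have h1 := hw0 n x
    have h2 := hM x
    gcongr
    linarith
  have hγt : ∀ᵐ x ∂ν, Tendsto (fun n => η x ^ 2 / (w n x + ε) ^ 2) atTop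
      (𝓝 (η x ^ 2 / (u x + ε) ^ 2)) := by
    filter_upwards [hwt, hpos] with x h1 h2
    exact tendsto_const_nhds.div ((h1.add_const _).pow 2) (pow_pos (by linarith) 2).ne'
  have hβub : ∀ᵐ x ∂ν, |1 / (u x + ε)| ≤ 1 / ε := by
    filter_upwards [hβt] with x h1
    exact le_of_tendsto h1.abs (Eventually.of_forall fun n => hβb n x)
  have hγub : ∀ᵐ x ∂ν, |η x ^ 2 / (u x + ε) ^ 2| ≤ M ^ 2 / ε ^ 2 := by
    filter_upwards [hγt] with x h1
    exact le_of_tendsto h1.abs (Eventually.of_forall fun n => hγb n x)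
  have hA2 : ∀ i, MemLp (fun x => 2 * η x * g i x * (1 / (u x + ε))) 2 ν := fun i =>
    memLp_mul_of_bound (hηg2 i)
      (aestronglyMeasurable_of_tendsto_ae atTop (fun n => (hβm n).aestronglyMeasurable) hβt) hβub
  have hC2 : ∀ i, MemLp (fun x => p i x * (η x ^ 2 / (u x + ε) ^ 2)) 2 ν := fun i =>
    memLp_mul_of_bound (hp2 i)
      (aestronglyMeasurable_of_tendsto_ae atTop (fun n => (hγm n).aestronglyMeasurable) hγt) hγub
  have hAn2 : ∀ n i, MemLp (fun x => 2 * η x * g i x * (1 / (w n x + ε))) 2 ν := fun n i =>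
    memLp_mul_of_bound (hηg2 i) (hβm n).aestronglyMeasurable (ae_of_all _ (hβb n))
  have hCn2 : ∀ n i, MemLp (fun x => r n i x * (η x ^ 2 / (w n x + ε) ^ 2)) 2 ν := fun n i =>
    memLp_mul_of_bound (hr2 n i) (hγm n).aestronglyMeasurable (ae_of_all _ (hγb n))
  have hAt : ∀ i, Tendsto (fun n => ∫ x, 2 * η x * g i x * (1 / (w n x + ε)) * q i x ∂ν) atTop
      (𝓝 (∫ x, 2 * η x * g i x * (1 / (u x + ε)) * q i x ∂ν)) := fun i =>
    tendsto_integral_mul_of_sq (hA2 i) (fun n => hAn2 n i) (hq2 i)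
      (tendsto_lintegral_sq_mul (F := fun _ x => 2 * η x * g i x) (hηg2 i)
        (fun _ => (hηg2 i).1) (fun n => (hβm n).aestronglyMeasurable) (by simp)
        (fun n => ae_of_all _ (hβb n)) hβt)
  have hCt : ∀ i, Tendsto (fun n => ∫ x, r n i x * (η x ^ 2 / (w n x + ε) ^ 2) * q i x ∂ν) atTop
      (𝓝 (∫ x, p i x * (η x ^ 2 / (u x + ε) ^ 2) * q i x ∂ν)) := fun i =>
    tendsto_integral_mul_of_sq (hC2 i) (fun n => hCn2 n i) (hq2 i)
      (tendsto_lintegral_sq_mul (hp2 i) (fun n => (hr2 n i).1)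
        (fun n => (hγm n).aestronglyMeasurable) (hrt i) (fun n => ae_of_all _ (hγb n)) hγt)
  -- `w n` is smooth and nonnegative on the whole space, so `η² / (w n + ε)` is a test function
  have hsupp : ∀ n, Function.support (fun x => η x ^ 2 / (w n x + ε)) ⊆ Function.support η :=
    fun n x hx h => hx (by simp [h])
  let ψ : ℕ → 𝓓(Ω, ℝ) := fun n => ⟨fun x => η x ^ 2 / (w n x + ε),
    (η.contDiff.pow 2).div ((hws n).add contDiff_const) fun x => (hwε n x).ne',
    η.hasCompactSupport.mono (hsupp n), (closure_mono (hsupp n)).trans η.tsupport_subset⟩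
  have hψ : ∀ n x, ψ n x = η x ^ 2 / (w n x + ε) := fun _ _ => rfl
  have hev : ∀ᶠ n in atTop, ∀ i x, fderiv ℝ (ψ n) x (EuclideanSpace.single i 1)
      = 2 * η x * g i x * (1 / (w n x + ε)) - r n i x * (η x ^ 2 / (w n x + ε) ^ 2) := by
    obtain ⟨δ, hδ, hδΩ⟩ := η.hasCompactSupport.exists_cthickening_subset_open Ω.isOpen
      η.tsupport_subset
    filter_upwards [tendsto_one_div_add_atTop_nhds_zero_nat.eventually_le_const hδ]
      with n hn i x
    have h1 := fderiv_sq_div_apply (η.contDiff.differentiable (by simp) x)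
      ((hws n).differentiable (by simp) x) (hwε n x).ne' (EuclideanSpace.single i 1)
    refine Eq.trans h1 ?_
    by_cases hx : x ∈ tsupport η
    · congr 2
      refine fderiv_mollify_apply_single (hu.1.isWeakPartialDeriv i) hloc ?_
      exact (closedBall_subset_closedBall hn).trans
        ((closedBall_subset_cthickening hx δ).trans hδΩ)
    · simp [image_eq_zero_of_notMem_tsupport hx]
  have hAi : ∀ n i, Integrable (fun x => 2 * η x * g i x * (1 / (w n x + ε)) * q i x) ν :=
    fun n i => (hAn2 n i).integrable_mul (hq2 i)
  have hCi : ∀ n i, Integrable (fun x => r n i x * (η x ^ 2 / (w n x + ε) ^ 2) * q i x) ν :=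
    fun n i => (hCn2 n i).integrable_mul (hq2 i)
  have hge : ∀ᶠ n in atTop, ∑ i, ∫ x, r n i x * (η x ^ 2 / (w n x + ε) ^ 2) * q i x ∂ν
      ≤ ∑ i, ∫ x, 2 * η x * g i x * (1 / (w n x + ε)) * q i x ∂ν := by
    filter_upwards [hev] with n hn
    have h1 := hu.2 (ψ n) (memW012_testFunction (ψ n)) (ae_of_all _ fun x => by
      rw [hψ]; exact div_nonneg (sq_nonneg _) (hwε n x).le)
    have h2 : bilinForm Ω a u (ψ n) = ∫ x, ∑ i, (2 * η x * g i x * (1 / (w n x + ε)) * q i x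
        - r n i x * (η x ^ 2 / (w n x + ε) ^ 2) * q i x) ∂ν := by
      refine integral_congr_ae ?_
      filter_upwards [ae_all_iff.2 fun i =>
        weakGrad_ae_eq (isWeakPartialDeriv_testFunction (ψ n) i)]
        with x hx
      simp only [dotProduct]
      refine Finset.sum_congr rfl fun i _ => ?_
      rw [hx i, hn i x, sub_mul]
    have h3 : ∀ i, Integrable (fun x => 2 * η x * g i x * (1 / (w n x + ε)) * q i x
        - r n i x * (η x ^ 2 / (w n x + ε) ^ 2) * q i x) ν := fun i => (hAi n i).sub (hCi n i)
    rw [h2, integral_finsetSum _ fun i _ => h3 i] at h1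
    simp_rw [fun i => integral_sub (hAi n i) (hCi n i)] at h1
    rw [Finset.sum_sub_distrib] at h1
    linarith
  have hlim := le_of_tendsto_of_tendsto (tendsto_finsetSum _ fun i _ => hCt i)
    (tendsto_finsetSum _ fun i _ => hAt i) hge
  have hAI : ∀ i, Integrable (fun x => 2 * η x * g i x * (1 / (u x + ε)) * q i x) ν :=
    fun i => (hA2 i).integrable_mul (hq2 i)
  have hCI : ∀ i, Integrable (fun x => p i x * (η x ^ 2 / (u x + ε) ^ 2) * q i x) ν :=
    fun i => (hC2 i).integrable_mul (hq2 i)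
  rw [← integral_finsetSum _ fun i _ => hAI i, ← integral_finsetSum _ fun i _ => hCI i] at hlim
  set I := ∫ x, ∑ i, p i x * (η x ^ 2 / (u x + ε) ^ 2) * q i x ∂ν with hI
  have hgI : Integrable (fun x => ∑ i, g i x ^ 2) ν :=
    integrable_finsetSum _ fun i _ => (hg2 i).integrable_sq
  have hCs : Integrable (fun x => ∑ i, p i x * (η x ^ 2 / (u x + ε) ^ 2) * q i x) ν :=
    integrable_finsetSum _ fun i _ => hCI i
  have hys : ∫ x, ∑ i, 2 * η x * g i x * (1 / (u x + ε)) * q i x ∂ν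
      ≤ ∫ x, (2⁻¹ * (∑ i, p i x * (η x ^ 2 / (u x + ε) ^ 2) * q i x)
        + 2 * Lam * ∑ i, g i x ^ 2) ∂ν := by
    refine integral_mono_ae (integrable_finsetSum _ fun i _ => hAI i)
      ((hCs.const_mul _).add (hgI.const_mul _)) ?_
    filter_upwards [ha.ae_mulVec_dotProduct_self_le] with x hx
    have h1 := two_mul_dotProduct_le hLam (hx (weakGrad Ω u x)) (fun i => g i x)
      (η x / (u x + ε))
    refine le_trans (le_of_eq ?_) (h1.trans (le_of_eq ?_))
    · refine Finset.sum_congr rfl fun i _ => ?_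
      simp only [hq]
      ring
    · rw [Finset.mul_sum]
      congr 2
      refine Finset.sum_congr rfl fun i _ => ?_
      simp only [hq, hp, div_pow]
      ring
  rw [integral_add (hCs.const_mul _) (hgI.const_mul _), integral_const_mul,
    integral_const_mul] at hys
  have hfin : I ≤ 4 * Lam * ∫ x, ∑ i, g i x ^ 2 ∂ν := by linarith
  have hCnn : ∀ᵐ x ∂ν, η x ^ 2 / (u x + ε) ^ 2 * ∑ i, weakGrad Ω u x i ^ 2
      ≤ ∑ i, p i x * (η x ^ 2 / (u x + ε) ^ 2) * q i x := by
    filter_upwards [ha.coercive] with x hx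
    have h1 := hx (weakGrad Ω u x)
    rw [one_mul] at h1
    simp only [dotProduct, ← sq] at h1
    refine (mul_le_mul_of_nonneg_left h1 (by positivity)).trans (le_of_eq ?_)
    rw [Finset.mul_sum]
    refine Finset.sum_congr rfl fun i _ => ?_
    simp only [hq, hp]
    ring
  calc ∫⁻ x, ENNReal.ofReal (η x ^ 2 / (u x + ε) ^ 2 * ∑ i, weakGrad Ω u x i ^ 2) ∂ν
      ≤ ∫⁻ x, ENNReal.ofReal (∑ i, p i x * (η x ^ 2 / (u x + ε) ^ 2) * q i x) ∂ν := by
        refine lintegral_mono_ae ?_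
        filter_upwards [hCnn] with x hx
        exact ENNReal.ofReal_le_ofReal hx
    _ = ENNReal.ofReal I := by
        rw [hI, ofReal_integral_eq_lintegral_ofReal hCs]
        filter_upwards [hCnn] with x hx
        exact le_trans (mul_nonneg (by positivity)
          (Finset.sum_nonneg fun i _ => sq_nonneg _)) hx
    _ ≤ _ := ENNReal.ofReal_le_ofReal hfin

end Caccioppoli

/-! ### The Morrey bound for the logarithmic gradient -/

section Morrey

variable {d : ℕ}

/-- Cutoff functions equal to one on `B(x,r)`, supported in the ball of radius `3r/2`, with partial
derivatives of size `1 / r`, uniformly in the centre and the radius. -/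
theorem exists_cutoff (d : ℕ) : ∃ M : ℝ, 0 ≤ M ∧ ∀ (Ω : Opens (EuclideanSpace ℝ (Fin d)))
    (x : EuclideanSpace ℝ (Fin d)) (r : ℝ), 0 < r → closedBall x (3 / 2 * r) ⊆ Ω →
    ∃ η : 𝓓(Ω, ℝ), (∀ y ∈ ball x r, η y = 1) ∧
      ∀ (i : Fin d) (y : EuclideanSpace ℝ (Fin d)),
        fderiv ℝ η y (EuclideanSpace.single i 1) ^ 2
          ≤ (closedBall x (3 / 2 * r)).indicator (fun _ => (M / r) ^ 2) y := by
  let χ : ContDiffBump (0 : EuclideanSpace ℝ (Fin d)) := ⟨1, 3 / 2, one_pos, by norm_num⟩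
  have hχ : ContDiff ℝ (⊤ : ℕ∞) χ := χ.contDiff
  obtain ⟨M, hM⟩ := (hχ.continuous_fderiv (by simp)).bounded_above_of_compact_support
    (χ.hasCompactSupport.fderiv ℝ)
  refine ⟨M, (norm_nonneg _).trans (hM 0), fun Ω x r hr hΩ => ?_⟩
  set η : EuclideanSpace ℝ (Fin d) → ℝ := fun y => χ (r⁻¹ • (y - x)) with hη
  have hηs : ContDiff ℝ (⊤ : ℕ∞) η := hχ.comp ((contDiff_id.sub contDiff_const).const_smul r⁻¹)
  have hηt : tsupport η ⊆ closedBall x (3 / 2 * r) := by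
    refine closure_minimal (fun y hy => ?_) isClosed_closedBall
    have h1 : r⁻¹ • (y - x) ∈ Function.support χ := hy
    rw [χ.support_eq, mem_ball, dist_zero_right, norm_smul, norm_inv,
      Real.norm_of_nonneg hr.le, inv_mul_lt_iff₀ hr] at h1
    rw [mem_closedBall, dist_eq_norm, mul_comm]
    exact h1.le
  refine ⟨⟨η, hηs, HasCompactSupport.of_support_subset_isCompact (isCompact_closedBall x _)
    ((subset_tsupport η).trans hηt), hηt.trans hΩ⟩, fun y hy => ?_, fun i y => ?_⟩
  · refine χ.one_of_mem_closedBall ?_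
    rw [mem_closedBall, dist_zero_right, norm_smul, norm_inv, Real.norm_of_nonneg hr.le,
      inv_mul_le_iff₀ hr, ← dist_eq_norm]
    exact (mem_ball.1 hy).le.trans (by simp [χ])
  · change fderiv ℝ η y (EuclideanSpace.single i 1) ^ 2 ≤ _
    by_cases hy : y ∈ closedBall x (3 / 2 * r)
    · rw [indicator_of_mem hy]
      have h1 : HasFDerivAt (fun y : EuclideanSpace ℝ (Fin d) => r⁻¹ • (y - x))
          (r⁻¹ • ContinuousLinearMap.id ℝ (EuclideanSpace ℝ (Fin d))) y :=
        ((hasFDerivAt_id y).sub_const x).const_smul r⁻¹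
      have h2 : HasFDerivAt η ((fderiv ℝ χ (r⁻¹ • (y - x))).comp
          (r⁻¹ • ContinuousLinearMap.id ℝ (EuclideanSpace ℝ (Fin d)))) y :=
        HasFDerivAt.comp (g := χ) (f := fun y : EuclideanSpace ℝ (Fin d) => r⁻¹ • (y - x)) y
          (hχ.differentiable (by simp) (r⁻¹ • (y - x))).hasFDerivAt h1
      rw [← sq_abs, h2.fderiv]
      simp only [ContinuousLinearMap.comp_apply, smul_apply,
        ContinuousLinearMap.id_apply, map_smul, smul_eq_mul, abs_mul]
      rw [abs_of_pos (inv_pos.2 hr), mul_comm, ← div_eq_mul_inv]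
      have h3 : |fderiv ℝ χ (r⁻¹ • (y - x)) (EuclideanSpace.single i 1)| ≤ M := by
        rw [← Real.norm_eq_abs]
        refine ((fderiv ℝ χ (r⁻¹ • (y - x))).le_opNorm _).trans ?_
        simpa using hM (r⁻¹ • (y - x))
      gcongr
    · rw [indicator_of_notMem hy]
      have h1 : fderiv ℝ η y = 0 := image_eq_zero_of_notMem_tsupport fun h =>
        hy (hηt (tsupport_fderiv_subset ℝ h))
      simp [h1]

/-- The `ℓ¹` norm of the weak gradient of `log (u + ε)`, as given by the chain rule. -/
noncomputable def logGrad (Ω : Opens (EuclideanSpace ℝ (Fin d)))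
    (u : EuclideanSpace ℝ (Fin d) → ℝ) (ε : ℝ) (x : EuclideanSpace ℝ (Fin d)) : ℝ :=
  ∑ i, |weakGrad Ω u x i * (1 / (u x + ε))|

theorem logGrad_nonneg (Ω : Opens (EuclideanSpace ℝ (Fin d)))
    (u : EuclideanSpace ℝ (Fin d) → ℝ) (ε : ℝ) (x : EuclideanSpace ℝ (Fin d)) :
    0 ≤ logGrad Ω u ε x := Finset.sum_nonneg fun _ _ => abs_nonneg _

theorem aemeasurable_logGrad {Ω : Opens (EuclideanSpace ℝ (Fin d))}
    {u : EuclideanSpace ℝ (Fin d) → ℝ} (hu : MemW1 Ω 2 u) (ε : ℝ) :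
    AEMeasurable (logGrad Ω u ε) (volume.restrict Ω) := by
  unfold logGrad
  refine Finset.aemeasurable_fun_sum _ fun i _ => ?_
  exact ((hu.memLp_weakGrad i).1.aemeasurable.mul
    ((hu.1.1.aemeasurable.add_const ε).const_div 1)).abs

/-- The Morrey bound `∫_{B(x,r)} |∇ log (u + ε)| ≤ K Λ^{1/2} rᵈ⁻¹`, from the logarithmic energy
estimate and Cauchy–Schwarz. The bound is uniform in `ε`. -/
theorem exists_lintegral_ball_logGrad_le (d : ℕ) : ∃ K : ℝ, 0 < K ∧
    ∀ (Ω : Opens (EuclideanSpace ℝ (Fin d))) (Lam : ℝ)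
      (a : EuclideanSpace ℝ (Fin d) → Matrix (Fin d) (Fin d) ℝ)
      (u : EuclideanSpace ℝ (Fin d) → ℝ), IsEllipticCoeff Ω 1 Lam a → IsWeakSupersolution Ω a u →
      (∀ᵐ x ∂volume.restrict (Ω : Set (EuclideanSpace ℝ (Fin d))), 0 < u x) →
      ∀ (ε : ℝ) (x : EuclideanSpace ℝ (Fin d)) (r : ℝ), 0 < ε → 0 < r →
        closedBall x (3 / 2 * r) ⊆ Ω →
        (∫⁻ z in ball x r, ENNReal.ofReal (logGrad Ω u ε z)) * ENNReal.ofReal r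
          ≤ ENNReal.ofReal (K * √Lam) * ENNReal.ofReal (r ^ d) := by
  obtain ⟨M, hM0, hM⟩ := exists_cutoff d
  set V : ℝ := volume.real (ball (0 : EuclideanSpace ℝ (Fin d)) 1) with hV
  have hV0 : 0 ≤ V := measureReal_nonneg
  refine ⟨2 * d * M * V * 2 ^ d + 1, by positivity, ?_⟩
  intro Ω Lam a u ha hu hpos ε x r hε hr hΩ
  have hLam : 0 < Lam := one_pos.trans_le ha.lam_le
  obtain ⟨η, hη1, hηd⟩ := hM Ω x r hr hΩ
  have hbΩ : ball x r ⊆ Ω :=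
    (ball_subset_closedBall.trans (closedBall_subset_closedBall (by linarith))).trans hΩ
  have hgrad : ∫ y in Ω, ∑ i, fderiv ℝ η y (EuclideanSpace.single i 1) ^ 2
      ≤ d * (M / r) ^ 2 * ((3 / 2 * r) ^ d * V) := by
    have hI : Integrable ((closedBall x (3 / 2 * r)).indicator
        fun _ : EuclideanSpace ℝ (Fin d) => d * (M / r) ^ 2) :=
      (integrable_indicator_iff measurableSet_closedBall).2
        (integrableOn_const (isCompact_closedBall x _).measure_lt_top.ne)
    have h1 : ∀ y, ∑ i, fderiv ℝ η y (EuclideanSpace.single i 1) ^ 2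
        ≤ (closedBall x (3 / 2 * r)).indicator (fun _ => d * (M / r) ^ 2) y := by
      intro y
      refine (Finset.sum_le_sum fun i _ => hηd i y).trans (le_of_eq ?_)
      by_cases hy : y ∈ closedBall x (3 / 2 * r) <;> simp [hy]
    calc ∫ y in Ω, ∑ i, fderiv ℝ η y (EuclideanSpace.single i 1) ^ 2
        ≤ ∫ y in Ω, (closedBall x (3 / 2 * r)).indicator (fun _ => d * (M / r) ^ 2) y :=
          integral_mono_of_nonneg (ae_of_all _ fun y => Finset.sum_nonneg fun i _ => sq_nonneg _)
            hI.integrableOn (ae_of_all _ h1)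
      _ ≤ ∫ y, (closedBall x (3 / 2 * r)).indicator (fun _ => d * (M / r) ^ 2) y :=
          setIntegral_le_integral hI (ae_of_all _ fun y =>
            indicator_nonneg (fun _ _ => by positivity) y)
      _ = d * (M / r) ^ 2 * ((3 / 2 * r) ^ d * V) := by
          rw [integral_indicator_const _ measurableSet_closedBall, smul_eq_mul, mul_comm,
            measureReal_def, Measure.addHaar_closedBall _ _ (by positivity)]
          simp only [finrank_euclideanSpace_fin, ENNReal.toReal_mul, hV, measureReal_def,
            ENNReal.toReal_ofReal (show 0 ≤ (3 / 2 * r) ^ d by positivity)]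
  have hcacc := lintegral_sq_mul_log_grad_le ha hu hpos hε η
  have hsq : ∫⁻ z in ball x r, ENNReal.ofReal (logGrad Ω u ε z) ^ 2
      ≤ ENNReal.ofReal (d * (4 * Lam * (d * (M / r) ^ 2 * ((3 / 2 * r) ^ d * V)))) := by
    calc ∫⁻ z in ball x r, ENNReal.ofReal (logGrad Ω u ε z) ^ 2
        ≤ ∫⁻ z in ball x r, ENNReal.ofReal d *
            ENNReal.ofReal (η z ^ 2 / (u z + ε) ^ 2 * ∑ i, weakGrad Ω u z i ^ 2) := by
          refine setLIntegral_mono' measurableSet_ball fun z hz => ?_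
          rw [← ENNReal.ofReal_pow (logGrad_nonneg _ _ _ _), ← ENNReal.ofReal_mul (by positivity)]
          refine ENNReal.ofReal_le_ofReal ?_
          have h1 := sq_sum_le_card_mul_sum_sq (s := Finset.univ)
            (f := fun i => |weakGrad Ω u z i * (1 / (u z + ε))|)
          refine h1.trans (le_of_eq ?_)
          rw [hη1 z hz, Finset.mul_sum]
          simp [mul_pow, Finset.mul_sum, mul_comm]
      _ = ENNReal.ofReal d * ∫⁻ z in ball x r,
            ENNReal.ofReal (η z ^ 2 / (u z + ε) ^ 2 * ∑ i, weakGrad Ω u z i ^ 2) :=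
          lintegral_const_mul' _ _ ENNReal.ofReal_ne_top
      _ ≤ ENNReal.ofReal d *
            ENNReal.ofReal (4 * Lam * (d * (M / r) ^ 2 * ((3 / 2 * r) ^ d * V))) := by
          refine mul_le_mul_right ((lintegral_mono_set hbΩ).trans (hcacc.trans ?_)) _
          exact ENNReal.ofReal_le_ofReal (mul_le_mul_of_nonneg_left hgrad (by positivity))
      _ = _ := (ENNReal.ofReal_mul (by positivity)).symm
  have hm : AEMeasurable (fun z => ENNReal.ofReal (logGrad Ω u ε z)) (volume.restrict (ball x r)) :=
    ((aemeasurable_logGrad hu.1 ε).mono_measure (Measure.restrict_mono hbΩ le_rfl)).ennreal_ofReal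
  have hcs := sq_lintegral_le _ hm
  rw [Measure.restrict_apply_univ] at hcs
  have hvol : volume (ball x r) = ENNReal.ofReal (r ^ d * V) := by
    rw [Measure.addHaar_ball_of_pos _ _ hr, ENNReal.ofReal_mul (by positivity), hV,
      ofReal_measureReal measure_ball_lt_top.ne]
    simp
  rw [← ENNReal.ofReal_mul (by positivity)]
  refine (ENNReal.pow_le_pow_left_iff two_ne_zero).1 ?_
  rw [mul_pow, ← ENNReal.ofReal_pow hr.le, ← ENNReal.ofReal_pow (by positivity)]
  calc (∫⁻ z in ball x r, ENNReal.ofReal (logGrad Ω u ε z)) ^ 2 * ENNReal.ofReal (r ^ 2)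
      ≤ (ENNReal.ofReal (r ^ d * V) *
          ENNReal.ofReal (d * (4 * Lam * (d * (M / r) ^ 2 * ((3 / 2 * r) ^ d * V)))))
          * ENNReal.ofReal (r ^ 2) := by
        refine mul_le_mul_left (hcs.trans ?_) _
        rw [hvol]
        exact mul_le_mul_right hsq _
    _ = ENNReal.ofReal (Lam * (2 * d * M * V) ^ 2 * (3 / 2) ^ d * (r ^ d) ^ 2) := by
        rw [← ENNReal.ofReal_mul (by positivity), ← ENNReal.ofReal_mul (by positivity)]
        congr 1
        rw [mul_pow]
        field_simp
        ring
    _ ≤ _ := by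
        refine ENNReal.ofReal_le_ofReal ?_
        rw [mul_pow _ (r ^ d), mul_pow _ √Lam, Real.sq_sqrt hLam.le]
        refine mul_le_mul_of_nonneg_right ?_ (by positivity)
        have h1 : ((3 : ℝ) / 2) ^ d ≤ (2 ^ d) ^ 2 := by
          rw [← pow_mul, mul_comm d 2, pow_mul]
          exact pow_le_pow_left₀ (by norm_num) (by norm_num) d
        have h2 : (2 * d * M * V) ^ 2 * (3 / 2) ^ d ≤ (2 * d * M * V * 2 ^ d + 1) ^ 2 := by
          calc (2 * d * M * V) ^ 2 * (3 / 2) ^ d ≤ (2 * d * M * V) ^ 2 * (2 ^ d) ^ 2 :=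
                mul_le_mul_of_nonneg_left h1 (sq_nonneg _)
            _ = (2 * d * M * V * 2 ^ d) ^ 2 := by ring
            _ ≤ _ := by gcongr; linarith
        nlinarith [mul_le_mul_of_nonneg_left h2 hLam.le]

end Morrey

/-! ### Oscillation of the logarithm -/

section LogOscillation

variable {d : ℕ} {u : EuclideanSpace ℝ (Fin d) → ℝ}

theorem enorm_clm_le_sum (L : EuclideanSpace ℝ (Fin d) →L[ℝ] ℝ) :
    ‖L‖ₑ ≤ ∑ i, ‖L (EuclideanSpace.single i 1)‖ₑ := by
  have h : ‖L‖ ≤ ∑ i, ‖L (EuclideanSpace.single i 1)‖ := by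
    refine L.opNorm_le_bound (Finset.sum_nonneg fun _ _ => norm_nonneg _) fun z => ?_
    have hz : z = ∑ i, z i • EuclideanSpace.single i (1 : ℝ) := by
      simpa using ((EuclideanSpace.basisFun (Fin d) ℝ).sum_repr z).symm
    calc ‖L z‖ = ‖∑ i, z i • L (EuclideanSpace.single i 1)‖ := by
          conv_lhs => rw [hz]
          rw [map_sum]
          simp only [map_smul]
      _ ≤ ∑ i, ‖z i • L (EuclideanSpace.single i 1)‖ := norm_sum_le _ _
      _ ≤ ∑ i, ‖L (EuclideanSpace.single i 1)‖ * ‖z‖ := by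
          refine Finset.sum_le_sum fun i _ => ?_
          rw [norm_smul, mul_comm]
          exact mul_le_mul_of_nonneg_left (PiLp.norm_apply_le z i) (norm_nonneg _)
      _ = _ := by rw [Finset.sum_mul]
  calc ‖L‖ₑ = ENNReal.ofReal ‖L‖ := (ofReal_norm L).symm
    _ ≤ ENNReal.ofReal (∑ i, ‖L (EuclideanSpace.single i 1)‖) := ENNReal.ofReal_le_ofReal h
    _ = ∑ i, ENNReal.ofReal ‖L (EuclideanSpace.single i 1)‖ :=
        ENNReal.ofReal_sum_of_nonneg fun _ _ => norm_nonneg _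
    _ = _ := by simp only [ofReal_norm]

theorem ballPotential_congr_ae {h k : EuclideanSpace ℝ (Fin d) → ℝ≥0∞} (hk : h =ᵐ[volume] k)
    (s : ℝ) (x : EuclideanSpace ℝ (Fin d)) :
    ballPotential volume s h x = ballPotential volume s k x :=
  le_antisymm (ballPotential_mono _ hk.le x) (ballPotential_mono _ hk.symm.le x)

/-- The potentials of functions tending to zero in `L¹` tend to zero in `L¹`, and Fatou's lemma
turns this into a pointwise statement. -/
theorem ae_liminf_ballPotential_eq_zero {e : ℕ → EuclideanSpace ℝ (Fin d) → ℝ≥0∞}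
    (he : ∀ n, AEMeasurable (e n)) (h0 : Tendsto (fun n => ∫⁻ z, e n z) atTop (𝓝 0)) (s : ℝ) :
    ∀ᵐ x, liminf (fun n => ballPotential volume s (e n) x) atTop = 0 := by
  have hcongr : ∀ n, ballPotential volume s (e n) = ballPotential volume s ((he n).mk (e n)) :=
    fun n => funext fun x => ballPotential_congr_ae (he n).ae_eq_mk s x
  have hm : ∀ n, Measurable (ballPotential volume s (e n)) := fun n => by
    rw [hcongr n]
    exact measurable_ballPotential volume (he n).measurable_mk s
  have hint : ∀ n, ∫⁻ x, ballPotential volume s (e n) x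
      = ENNReal.ofReal s * (volume (ball (0 : EuclideanSpace ℝ (Fin d)) 1) * ∫⁻ z, e n z) := by
    intro n
    rw [hcongr n, lintegral_ballPotential volume (he n).measurable_mk,
      lintegral_congr_ae (he n).ae_eq_mk]
  have ht : Tendsto (fun n => ∫⁻ x, ballPotential volume s (e n) x) atTop (𝓝 0) := by
    simp_rw [hint]
    have h1 := ENNReal.Tendsto.const_mul (a := ENNReal.ofReal s)
      (ENNReal.Tendsto.const_mul (a := volume (ball (0 : EuclideanSpace ℝ (Fin d)) 1)) h0
        (Or.inr measure_ball_lt_top.ne)) (Or.inr ENNReal.ofReal_ne_top)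
    simpa using h1
  have hle := lintegral_liminf_le (μ := volume) (u := atTop) hm
  rw [ht.liminf_eq] at hle
  exact (lintegral_eq_zero_iff (Measurable.liminf hm)).1 (le_antisymm hle bot_le)

/-- The potential estimate for the oscillation of `log (u + ε)`. It holds for the logarithm of the
mollifications of `u`, and passes to the limit by Fatou's lemma because the gradients converge in
`L¹`; no chain rule for weak derivatives is needed. -/
theorem ae_lintegral_enorm_log_sub_le (hu : MemW1 (unitBall d) 2 u)
    (hpos : ∀ᵐ x ∂volume.restrict (ball (0 : EuclideanSpace ℝ (Fin d)) 1), 0 < u x)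
    {ε : ℝ} (hε : 0 < ε) :
    ∀ᵐ x ∂volume.restrict (ball (0 : EuclideanSpace ℝ (Fin d)) (1 / 2)),
      ∫⁻ y in ball (0 : EuclideanSpace ℝ (Fin d)) (1 / 2),
          ‖Real.log (u x + ε) - Real.log (u y + ε)‖ₑ
        ≤ ballPotential volume 1 ((ball (0 : EuclideanSpace ℝ (Fin d)) (1 / 2)).indicator
          fun z => ENNReal.ofReal (logGrad (unitBall d) u ε z)) x := by
  set S : Set (EuclideanSpace ℝ (Fin d)) := ball 0 1 with hS
  set B : Set (EuclideanSpace ℝ (Fin d)) := ball 0 (1 / 2) with hB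
  have hBS : B ⊆ S := ball_subset_ball (by norm_num)
  have hBm : MeasurableSet B := measurableSet_ball
  set p : Fin d → EuclideanSpace ℝ (Fin d) → ℝ := fun i x => weakGrad (unitBall d) u x i with hp
  set w : ℕ → EuclideanSpace ℝ (Fin d) → ℝ := fun n => mollify volume n (S.indicator u) with hw
  set r : ℕ → Fin d → EuclideanSpace ℝ (Fin d) → ℝ := fun n i =>
    mollify volume n (S.indicator (p i)) with hr
  have hp2 : ∀ i, MemLp (p i) 2 (volume.restrict S) := hu.memLp_weakGrad
  have hloc : LocallyIntegrable (S.indicator u) :=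
    (memLp_indicator (Ω := unitBall d) hu.1).locallyIntegrable one_le_two
  have hws : ∀ n, ContDiff ℝ (⊤ : ℕ∞) (w n) := contDiff_mollify volume hloc
  have hw0 : ∀ n x, 0 ≤ w n x := mollify_indicator_nonneg (Ω := unitBall d) hpos
  have hwε : ∀ n x, 0 < w n x + ε := fun n x => by linarith [hw0 n x]
  have hwt : ∀ᵐ x ∂volume.restrict S, Tendsto (fun n => w n x) atTop (𝓝 (u x)) :=
    ae_restrict_tendsto_mollify (Ω := unitBall d) hu.1
  have hr2 : ∀ n i, MemLp (r n i) 2 (volume.restrict S) := fun n i =>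
    (memLp_mollify volume (memLp_indicator (Ω := unitBall d) (hp2 i)) n).restrict _
  have hrt : ∀ i, Tendsto (fun n => ∫⁻ x in S, ‖r n i x - p i x‖ₑ ^ 2) atTop (𝓝 0) := fun i =>
    tendsto_setLIntegral_sq_mollify (Ω := unitBall d) (hp2 i)
  have hβm : ∀ n, Continuous fun x => 1 / (w n x + ε) := fun n =>
    continuous_const.div ((hws n).continuous.add continuous_const) fun x => (hwε n x).ne'
  have hβb : ∀ n x, |1 / (w n x + ε)| ≤ 1 / ε := fun n x => by
    rw [abs_of_pos (one_div_pos.2 (hwε n x))]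
    exact one_div_le_one_div_of_le hε (by linarith [hw0 n x])
  have hβt : ∀ᵐ x ∂volume.restrict S,
      Tendsto (fun n => 1 / (w n x + ε)) atTop (𝓝 (1 / (u x + ε))) := by
    filter_upwards [hwt, hpos] with x h1 h2
    exact tendsto_const_nhds.div (h1.add_const _) (by linarith)
  have hpβ : ∀ i, MemLp (fun x => p i x * (1 / (u x + ε))) 2 (volume.restrict S) := fun i =>
    memLp_mul_of_bound (hp2 i)
      (aestronglyMeasurable_of_tendsto_ae atTop (fun n => (hβm n).aestronglyMeasurable) hβt) (by
        filter_upwards [hβt] with x h1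
        exact le_of_tendsto h1.abs (Eventually.of_forall fun n => hβb n x))
  have hrβ : ∀ n i, MemLp (fun x => r n i x * (1 / (w n x + ε))) 2 (volume.restrict S) :=
    fun n i => memLp_mul_of_bound (hr2 n i) (hβm n).aestronglyMeasurable (ae_of_all _ (hβb n))
  have : IsFiniteMeasure (volume.restrict S) := ⟨by simp [hS, measure_ball_lt_top]⟩
  have hdiff : ∀ i, Tendsto (fun n => ∫⁻ x in S,
      ‖r n i x * (1 / (w n x + ε)) - p i x * (1 / (u x + ε))‖ₑ) atTop (𝓝 0) := fun i => by
    have h1 := tendsto_lintegral_mul_of_sq (hpβ i) (fun n => (hrβ n i).1)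
      (memLp_const (1 : ℝ)) (tendsto_lintegral_sq_mul (hp2 i) (fun n => (hr2 n i).1)
        (fun n => (hβm n).aestronglyMeasurable) (hrt i) (fun n => ae_of_all _ (hβb n)) hβt)
    simpa only [mul_one] using h1
  -- the gradient of `log (w n + ε)` differs from that of `log (u + ε)` by an error `e n`
  set h : EuclideanSpace ℝ (Fin d) → ℝ≥0∞ :=
    B.indicator fun z => ENNReal.ofReal (logGrad (unitBall d) u ε z) with hh
  set e : ℕ → EuclideanSpace ℝ (Fin d) → ℝ≥0∞ := fun n => B.indicator fun z =>
    ∑ i, ‖r n i z * (1 / (w n z + ε)) - p i z * (1 / (u z + ε))‖ₑ with he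
  have hrest : volume.restrict B ≤ volume.restrict S := Measure.restrict_mono hBS le_rfl
  have hhm : AEMeasurable h := (aemeasurable_indicator_iff hBm).2
    ((aemeasurable_logGrad hu ε).mono_measure hrest).ennreal_ofReal
  have hem : ∀ n, AEMeasurable (e n) := fun n => (aemeasurable_indicator_iff hBm).2
    (Finset.aemeasurable_fun_sum _ fun i _ =>
      (((hrβ n i).1.sub (hpβ i).1).mono_measure hrest).enorm)
  have he0 : Tendsto (fun n => ∫⁻ z, e n z) atTop (𝓝 0) := by
    have h1 := tendsto_finsetSum Finset.univ fun i _ => hdiff i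
    rw [Finset.sum_const_zero] at h1
    refine tendsto_of_tendsto_of_tendsto_of_le_of_le tendsto_const_nhds h1
      (fun _ => bot_le) fun n => ?_
    simp only [he]
    rw [lintegral_indicator hBm]
    refine (lintegral_mono_set hBS).trans (le_of_eq ?_)
    exact lintegral_finsetSum' _ fun i _ => ((hrβ n i).1.sub (hpβ i).1).enorm
  have hlogs : ∀ n, ContDiff ℝ 1 fun x => Real.log (w n x + ε) := fun n =>
    (((hws n).of_le (by exact_mod_cast le_top)).add contDiff_const).log fun x => (hwε n x).ne'
  have hgradle : ∀ n, 2 ≤ n → ∀ z,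
      B.indicator (fun z => ‖fderiv ℝ (fun x => Real.log (w n x + ε)) z‖ₑ) z ≤ h z + e n z := by
    intro n hn z
    by_cases hz : z ∈ B
    · simp only [hh, he, indicator_of_mem hz]
      refine (enorm_clm_le_sum _).trans ?_
      rw [logGrad, ENNReal.ofReal_sum_of_nonneg fun _ _ => abs_nonneg _, ← Finset.sum_add_distrib]
      refine Finset.sum_le_sum fun i _ => ?_
      -- `1/2 + 1/3 < 1`, so mollification commutes with differentiation on `B` once `n ≥ 2`
      have hsub : closedBall z (1 / (n + 1)) ⊆ (unitBall d : Set (EuclideanSpace ℝ (Fin d))) := by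
        refine closedBall_subset_ball' ?_
        have h2 : (1 : ℝ) / (n + 1) ≤ 1 / 3 := by
          have : (2 : ℝ) ≤ n := by exact_mod_cast hn
          exact one_div_le_one_div_of_le (by norm_num) (by linarith)
        have h3 : dist z 0 < 1 / 2 := hz
        linarith
      have hd : fderiv ℝ (fun x => Real.log (w n x + ε)) z (EuclideanSpace.single i 1)
          = r n i z * (1 / (w n z + ε)) := by
        have h4 := (((hws n).differentiable (by simp) z).hasFDerivAt.add_const ε).log (hwε n z).ne'
        have h5 : fderiv ℝ (w n) z (EuclideanSpace.single i 1) = r n i z :=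
          fderiv_mollify_apply_single (hu.isWeakPartialDeriv i) hloc hsub
        rw [h4.fderiv]
        simp [h5, mul_comm]
      rw [hd, ← Real.norm_eq_abs, ofReal_norm]
      refine le_trans (le_of_eq ?_) (enorm_add_le _ _)
      rw [add_sub_cancel]
    · simp [hz]
  have hpot : ∀ n, 2 ≤ n → ∀ x ∈ B,
      ∫⁻ y in B, ‖Real.log (w n x + ε) - Real.log (w n y + ε)‖ₑ
        ≤ ballPotential volume 1 h x + ballPotential volume 1 (e n) x := by
    intro n hn x hx
    refine (lintegral_enorm_sub_le_ballPotential volume (hlogs n) (convex_ball _ _) hBm ?_ hx).trans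
      ((ballPotential_mono volume (ae_of_all _ (hgradle n hn)) x).trans (le_of_eq ?_))
    · intro y hy z hz
      have h1 : dist y 0 < 1 / 2 := hy
      have h2 : dist z 0 < 1 / 2 := hz
      linarith [dist_triangle_right y z 0]
    · rw [ballPotential_congr_ae hhm.ae_eq_mk, ← ballPotential_add volume hhm.measurable_mk]
      refine ballPotential_congr_ae ?_ _ _
      filter_upwards [hhm.ae_eq_mk] with z hz
      rw [hz]
  have hlogt : ∀ᵐ x ∂volume.restrict B, Tendsto (fun n => Real.log (w n x + ε)) atTop
      (𝓝 (Real.log (u x + ε))) := by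
    filter_upwards [ae_mono hrest hwt, ae_mono hrest hpos] with x h1 h2
    exact (h1.add_const ε).log (by linarith)
  filter_upwards [hlogt, ae_restrict_mem hBm,
    ae_restrict_of_ae (ae_liminf_ballPotential_eq_zero hem he0 1)] with x hx hxB hlim
  calc ∫⁻ y in B, ‖Real.log (u x + ε) - Real.log (u y + ε)‖ₑ
      = ∫⁻ y in B, liminf (fun n => ‖Real.log (w n x + ε) - Real.log (w n y + ε)‖ₑ) atTop := by
        refine lintegral_congr_ae ?_
        filter_upwards [hlogt] with y hy
        exact (hx.sub hy).enorm.liminf_eq.symm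
    _ ≤ liminf (fun n => ∫⁻ y in B, ‖Real.log (w n x + ε) - Real.log (w n y + ε)‖ₑ) atTop :=
        lintegral_liminf_le fun n =>
          (continuous_const.sub (hlogs n).continuous).enorm.measurable
    _ ≤ liminf (fun n => ballPotential volume 1 h x + ballPotential volume 1 (e n) x) atTop :=
        liminf_le_liminf (by
          filter_upwards [eventually_ge_atTop 2] with n hn
          exact hpot n hn x hxB)
    _ = ballPotential volume 1 h x := by
        rw [liminf_const_add _ _ _ (by isBoundedDefault) (by isBoundedDefault), hlim, add_zero]

end LogOscillation

/-! ### The product of the integrals of opposite powers -/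

section Integrability

/-- Exponential integrability of `v - m` bounds the product of the integrals of `exp (c v)` and
`exp (-c v)`, since the factors `exp (± c m)` cancel. -/
theorem lintegral_exp_mul_lintegral_exp_neg_le {α : Type*} [MeasurableSpace α] {ν : Measure α}
    {v : α → ℝ} {c m : ℝ} {C : ℝ≥0∞} (hc : 0 ≤ c)
    (h : ∫⁻ x, ENNReal.ofReal (Real.exp (c * |v x - m|)) ∂ν ≤ C) :
    (∫⁻ x, ENNReal.ofReal (Real.exp (c * v x)) ∂ν)
      * ∫⁻ x, ENNReal.ofReal (Real.exp (-c * v x)) ∂ν ≤ C ^ 2 := by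
  have key : ∀ s : ℝ, |s| ≤ c → ∫⁻ x, ENNReal.ofReal (Real.exp (s * v x)) ∂ν
      ≤ ENNReal.ofReal (Real.exp (s * m)) * C := by
    intro s hs
    refine le_trans ?_ (mul_le_mul_right h _)
    rw [← lintegral_const_mul' _ _ ENNReal.ofReal_ne_top]
    refine lintegral_mono fun x => ?_
    rw [← ENNReal.ofReal_mul (Real.exp_nonneg _), ← Real.exp_add]
    refine ENNReal.ofReal_le_ofReal (Real.exp_le_exp.2 ?_)
    have h1 : s * (v x - m) ≤ c * |v x - m| :=
      (le_abs_self _).trans (by rw [abs_mul]; gcongr)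
    linarith
  calc _ ≤ (ENNReal.ofReal (Real.exp (c * m)) * C) * (ENNReal.ofReal (Real.exp (-c * m)) * C) :=
        mul_le_mul' (key c (abs_of_nonneg hc).le) (key (-c) (by rw [abs_neg, abs_of_nonneg hc]))
    _ = (ENNReal.ofReal (Real.exp (c * m)) * ENNReal.ofReal (Real.exp (-c * m))) * C ^ 2 := by ring
    _ = C ^ 2 := by
        rw [← ENNReal.ofReal_mul (Real.exp_nonneg _), ← Real.exp_add]
        simp

theorem abs_log_add_le {s ε : ℝ} (hs : 0 ≤ s) (hε : 0 < ε) :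
    |Real.log (s + ε)| ≤ |Real.log ε| + s / ε := by
  have h1 : s + ε = ε * (1 + s / ε) := by field_simp; ring
  have h2 : (0 : ℝ) < 1 + s / ε := by positivity
  rw [h1, Real.log_mul hε.ne' h2.ne']
  refine (abs_add_le _ _).trans (add_le_add_right ?_ _)
  rw [abs_of_nonneg (Real.log_nonneg (le_add_of_nonneg_right (by positivity)))]
  linarith [Real.log_le_sub_one_of_pos h2]

variable {d : ℕ}

theorem ofReal_abs_sub_average_le {B : Set (EuclideanSpace ℝ (Fin d))}
    {v : EuclideanSpace ℝ (Fin d) → ℝ} (hv : IntegrableOn v B) (hB : volume B ≠ ∞)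
    (hB0 : volume B ≠ 0) (x : EuclideanSpace ℝ (Fin d)) :
    ENNReal.ofReal (volume.real B * |v x - ⨍ y in B, v y|) ≤ ∫⁻ y in B, ‖v x - v y‖ₑ := by
  have hV : volume.real B ≠ 0 := (ENNReal.toReal_pos hB0 hB).ne'
  have hc : Integrable (fun _ => v x) (volume.restrict B) := integrableOn_const hB
  have h1 : volume.real B * (v x - ⨍ y in B, v y) = ∫ y in B, (v x - v y) := by
    rw [integral_sub hc hv, setIntegral_const, setAverage_eq, smul_eq_mul,
      smul_eq_mul, mul_sub, mul_inv_cancel_left₀ hV]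
  have h2 : ENNReal.ofReal (volume.real B * |v x - ⨍ y in B, v y|)
      = ‖∫ y in B, (v x - v y)‖ₑ := by
    rw [← h1, ← ofReal_norm, norm_mul, Real.norm_of_nonneg measureReal_nonneg, Real.norm_eq_abs]
  rw [h2]
  exact enorm_integral_le_lintegral_enorm _

/-- The product estimate for `u + ε`, uniformly in `ε`. -/
theorem exists_lintegral_rpow_mul_le (d : ℕ) : ∃ c : ℝ, 0 < c ∧
    ∀ (Lam : ℝ) (a : EuclideanSpace ℝ (Fin d) → Matrix (Fin d) (Fin d) ℝ)
      (u : EuclideanSpace ℝ (Fin d) → ℝ), IsEllipticCoeff (unitBall d) 1 Lam a →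
      IsWeakSupersolution (unitBall d) a u →
      (∀ᵐ x ∂volume.restrict (ball (0 : EuclideanSpace ℝ (Fin d)) 1), 0 < u x) →
      ∀ ε : ℝ, 0 < ε →
        (∫⁻ x in ball 0 (1 / 2), ENNReal.ofReal ((u x + ε) ^ (c / √Lam))) *
          (∫⁻ x in ball 0 (1 / 2), ENNReal.ofReal ((u x + ε) ^ (-(c / √Lam))))
          ≤ expConst (volume : Measure (EuclideanSpace ℝ (Fin d))) ^ 2 := by
  obtain ⟨K₀, hK₀, hM⟩ := exists_lintegral_ball_logGrad_le d
  set B : Set (EuclideanSpace ℝ (Fin d)) := ball 0 (1 / 2) with hB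
  have hBt : volume B ≠ ∞ := measure_ball_lt_top.ne
  have hB0 : volume B ≠ 0 := (measure_ball_pos _ _ (by norm_num)).ne'
  have hV : 0 < volume.real B := ENNReal.toReal_pos hB0 hBt
  refine ⟨volume.real B / (2 ^ (d + 2) * K₀), by positivity, ?_⟩
  intro Lam a u ha hu hpos ε hε
  have hLam : 0 < Lam := one_pos.trans_le ha.lam_le
  have hsq : 0 < √Lam := Real.sqrt_pos.2 hLam
  set K : ℝ := 2 ^ (d + 1) * (K₀ * √Lam) with hK
  have hK0 : 0 < K := by positivity
  have hBS : B ⊆ ball 0 1 := ball_subset_ball (by norm_num)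
  have hBm : MeasurableSet B := measurableSet_ball
  have hrest : volume.restrict B ≤ volume.restrict (ball (0 : EuclideanSpace ℝ (Fin d)) 1) :=
    Measure.restrict_mono hBS le_rfl
  set G : EuclideanSpace ℝ (Fin d) → ℝ≥0∞ :=
    fun z => ENNReal.ofReal (logGrad (unitBall d) u ε z) with hG
  have hGm : AEMeasurable (B.indicator G) := (aemeasurable_indicator_iff hBm).2
    ((aemeasurable_logGrad hu.1 ε).mono_measure hrest).ennreal_ofReal
  have hmorrey : ∀ (x : EuclideanSpace ℝ (Fin d)) (r : ℝ), 0 < r → dist x 0 + 3 / 2 * r < 1 →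
      (∫⁻ z in ball x r, G z) * ENNReal.ofReal r ≤ ENNReal.ofReal (K₀ * √Lam * r ^ d) := by
    intro x r hr hxr
    rw [ENNReal.ofReal_mul (by positivity)]
    exact hM (unitBall d) Lam a u ha hu hpos ε x r hε hr
      ((closedBall_subset_ball' (by linarith)))
  have hind : ∀ x r, ∫⁻ z in ball x r, B.indicator G z ≤ ∫⁻ z in ball x r, G z := fun x r =>
    lintegral_mono fun z => indicator_le_self _ _ z
  have htot : ∀ x r, ∫⁻ z in ball x r, B.indicator G z ≤ ∫⁻ z, B.indicator G z := fun x r =>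
    setLIntegral_le_lintegral _ _
  have hI : ∫⁻ z, B.indicator G z ≤ ENNReal.ofReal (2 * (K₀ * √Lam) * (1 / 2) ^ d) := by
    rw [lintegral_indicator hBm]
    have h1 := hmorrey 0 (1 / 2) (by norm_num) (by norm_num)
    have h2 : ENNReal.ofReal (1 / 2) ≠ 0 := by simp
    rw [← ENNReal.le_div_iff_mul_le (Or.inl h2) (Or.inl ENNReal.ofReal_ne_top),
      ← ENNReal.ofReal_div_of_pos (by norm_num)] at h1
    refine h1.trans (le_of_eq ?_)
    congr 1
    ring
  have hIK : ∫⁻ z, B.indicator G z ≤ ENNReal.ofReal K := by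
    refine hI.trans (ENNReal.ofReal_le_ofReal ?_)
    have h1 : ((1 : ℝ) / 2) ^ d ≤ 2 ^ d := pow_le_pow_left₀ (by norm_num) (by norm_num) d
    rw [hK, pow_succ]
    nlinarith [mul_le_mul_of_nonneg_left h1 (by positivity : 0 ≤ 2 * (K₀ * √Lam))]
  have hMor : ∀ x ∈ B, ∀ r ∈ Ioo (0 : ℝ) 1, (∫⁻ z in ball x r, B.indicator G z)
      * ENNReal.ofReal r ≤ ENNReal.ofReal K * ENNReal.ofReal (r ^ d) := by
    intro x hx r hr
    have hx' : dist x 0 < 1 / 2 := hx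
    have hr0 := hr.1
    rw [← ENNReal.ofReal_mul hK0.le]
    -- for `r < 1/3` the ball `B(x, 3r/2)` stays inside the unit ball; for larger `r` the integral
    -- over all of `B`, bounded through the case of centre `0` and radius `1/2`, suffices
    rcases lt_or_ge r (1 / 3) with h3 | h3
    · refine (mul_le_mul_left (hind x r) _).trans ((hmorrey x r hr.1 (by linarith)).trans ?_)
      refine ENNReal.ofReal_le_ofReal (mul_le_mul_of_nonneg_right ?_ (by positivity))
      exact le_mul_of_one_le_left (by positivity) (one_le_pow₀ (by norm_num))
    · refine (mul_le_mul' ((htot x r).trans hI)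
        (ENNReal.ofReal_le_ofReal hr.2.le)).trans ?_
      rw [← ENNReal.ofReal_mul (by positivity), mul_one]
      refine ENNReal.ofReal_le_ofReal ?_
      have h1 : ((1 : ℝ) / 2) ^ d ≤ 2 ^ d * r ^ d := by
        rw [← mul_pow]
        exact pow_le_pow_left₀ (by norm_num) (by linarith) d
      rw [hK, pow_succ]
      nlinarith [mul_le_mul_of_nonneg_left h1 (by positivity : 0 ≤ 2 * (K₀ * √Lam))]
  set v : EuclideanSpace ℝ (Fin d) → ℝ := fun x => Real.log (u x + ε) with hv
  have hum : AEStronglyMeasurable u (volume.restrict B) := hu.1.1.1.mono_measure hrest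
  have hvm : AEMeasurable v (volume.restrict B) := (hum.aemeasurable.add_const ε).log
  have hposB : ∀ᵐ x ∂volume.restrict B, 0 < u x := ae_mono hrest hpos
  have hfin : IsFiniteMeasure (volume.restrict B) := ⟨by simpa using measure_ball_lt_top⟩
  have hvi : IntegrableOn v B := by
    have hui : Integrable u (volume.restrict B) :=
      (hu.1.1.mono_measure hrest).integrable one_le_two
    refine ((integrable_const |Real.log ε|).add (hui.div_const ε)).mono'
      hvm.aestronglyMeasurable ?_
    filter_upwards [hposB] with x hx
    exact abs_log_add_le hx.le hε
  set m := ⨍ y in B, v y with hm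
  have hexp := lintegral_exp_le volume hGm.measurable_mk hK0 hBm hBS
    (D := fun x => volume.real B * |v x - m|) (by
      intro x hx r hr
      rw [← lintegral_congr_ae (ae_restrict_of_ae hGm.ae_eq_mk), finrank_euclideanSpace_fin]
      exact hMor x hx r hr) (by rwa [← lintegral_congr_ae hGm.ae_eq_mk])
    ((hvm.sub_const m).abs.const_mul _) (by
      filter_upwards [ae_lintegral_enorm_log_sub_le hu.1 hpos hε] with x hx
      rw [← ballPotential_congr_ae hGm.ae_eq_mk]
      exact (ofReal_abs_sub_average_le hvi hBt hB0 x).trans hx)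
  have hc : volume.real B / (2 ^ (d + 2) * K₀) / √Lam = volume.real B / (2 * K) := by
    rw [hK]
    field_simp
    ring
  rw [hc]
  have hexp' : ∫⁻ x in B, ENNReal.ofReal (Real.exp (volume.real B / (2 * K) * |v x - m|))
      ≤ expConst (volume : Measure (EuclideanSpace ℝ (Fin d))) := by
    refine le_trans (le_of_eq (lintegral_congr fun x => ?_)) hexp
    rw [div_mul_eq_mul_div]
  refine le_trans (le_of_eq ?_)
    (lintegral_exp_mul_lintegral_exp_neg_le (by positivity) hexp')
  congr 1 <;>
  · refine lintegral_congr_ae ?_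
    filter_upwards [hposB] with x hx
    rw [Real.rpow_def_of_pos (by linarith), mul_comm]

/-- Removal of the regularisation `ε`. Finiteness of each factor follows from the bound on the
product, as neither factor vanishes. -/
theorem lintegral_rpow_mul_le_of_add {α : Type*} [MeasurableSpace α] {ν : Measure α} [NeZero ν]
    {u : α → ℝ} (hu : AEMeasurable u ν) (hpos : ∀ᵐ x ∂ν, 0 < u x) {c : ℝ} (hc : 0 ≤ c) {C : ℝ≥0∞}
    (hC : C ≠ ∞) (h : ∀ ε : ℝ, 0 < ε → (∫⁻ x, ENNReal.ofReal ((u x + ε) ^ c) ∂ν) *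
      (∫⁻ x, ENNReal.ofReal ((u x + ε) ^ (-c)) ∂ν) ≤ C) :
    (∫⁻ x, ENNReal.ofReal (u x ^ c) ∂ν) * (∫⁻ x, ENNReal.ofReal (u x ^ (-c)) ∂ν) ≤ C ∧
      ∫⁻ x, ENNReal.ofReal (u x ^ c) ∂ν ≠ ∞ ∧ ∫⁻ x, ENNReal.ofReal (u x ^ (-c)) ∂ν ≠ ∞ := by
  have hne : ∀ s : ℝ, ∫⁻ x, ENNReal.ofReal (u x ^ s) ∂ν ≠ 0 := by
    intro s h0
    rw [lintegral_eq_zero_iff' (hu.pow_const s).ennreal_ofReal] at h0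
    have hf : ∀ᵐ _ ∂ν, False := by
      filter_upwards [h0, hpos] with x h1 h2
      have h3 : 0 < u x ^ s := Real.rpow_pos_of_pos h2 s
      simp only [Pi.zero_apply, ENNReal.ofReal_eq_zero] at h1
      linarith
    exact NeZero.ne ν (ae_eq_bot.1 (eventually_false_iff_eq_bot.1 hf))
  set A := ∫⁻ x, ENNReal.ofReal (u x ^ c) ∂ν with hA
  have hAle : ∀ ε : ℝ, 0 < ε → A ≤ ∫⁻ x, ENNReal.ofReal ((u x + ε) ^ c) ∂ν := by
    intro ε hε
    refine lintegral_mono_ae ?_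
    filter_upwards [hpos] with x hx
    exact ENNReal.ofReal_le_ofReal (Real.rpow_le_rpow hx.le (by linarith) hc)
  have hBε : ∀ ε : ℝ, 0 < ε → ∫⁻ x, ENNReal.ofReal ((u x + ε) ^ (-c)) ∂ν ≤ C / A := by
    intro ε hε
    rw [ENNReal.le_div_iff_mul_le (Or.inl (hne c)) (Or.inr hC), mul_comm]
    exact (mul_le_mul_left (hAle ε hε) _).trans (h ε hε)
  have hBle : ∫⁻ x, ENNReal.ofReal (u x ^ (-c)) ∂ν ≤ C / A := by
    calc ∫⁻ x, ENNReal.ofReal (u x ^ (-c)) ∂ν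
        = ∫⁻ x, liminf (fun n : ℕ =>
            ENNReal.ofReal ((u x + 1 / ((n : ℝ) + 1)) ^ (-c))) atTop ∂ν := by
          refine lintegral_congr_ae ?_
          filter_upwards [hpos] with x hx
          have h1 : Tendsto (fun n : ℕ => u x + 1 / ((n : ℝ) + 1)) atTop (𝓝 (u x)) := by
            simpa using (tendsto_one_div_add_atTop_nhds_zero_nat (𝕜 := ℝ)).const_add (u x)
          exact (ENNReal.tendsto_ofReal
            (h1.rpow_const (Or.inl hx.ne'))).liminf_eq.symm
      _ ≤ liminf (fun n : ℕ => ∫⁻ x, ENNReal.ofReal ((u x + 1 / ((n : ℝ) + 1)) ^ (-c)) ∂ν) atTop :=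
          lintegral_liminf_le' fun n => ((hu.add_const _).pow_const _).ennreal_ofReal
      _ ≤ C / A := liminf_le_of_le (by isBoundedDefault) fun b hb => by
          obtain ⟨n, hn⟩ := hb.exists
          exact hn.trans (hBε _ (by positivity))
  have hAB : A * ∫⁻ x, ENNReal.ofReal (u x ^ (-c)) ∂ν ≤ C := by
    rw [mul_comm, ← ENNReal.le_div_iff_mul_le (Or.inl (hne c)) (Or.inr hC)]
    exact hBle
  refine ⟨hAB, fun hAt => ?_, fun hBt => ?_⟩
  · rw [hAt, ENNReal.top_mul (hne _)] at hAB
    exact hC (top_le_iff.1 hAB)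
  · rw [hBt, ENNReal.mul_top (hne _)] at hAB
    exact hC (top_le_iff.1 hAB)

end Integrability

end EllipticPDE

theorem theorem2p3 (d : ℕ) (hd : 3 ≤ d) :
    ∃ c' C' : ℝ, 0 < c' ∧ 0 < C' ∧
      ∀ (Lam : ℝ) (a : EuclideanSpace ℝ (Fin d) → Matrix (Fin d) (Fin d) ℝ)
        (u : EuclideanSpace ℝ (Fin d) → ℝ),
        EllipticPDE.IsEllipticCoeff (EllipticPDE.unitBall d) 1 Lam a →
        EllipticPDE.IsWeakSupersolution (EllipticPDE.unitBall d) a u →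
        (∀ᵐ x ∂(volume.restrict (Metric.ball (0 : EuclideanSpace ℝ (Fin d)) 1)), 0 < u x) →
        IntegrableOn (fun x => |u x| ^ (c' / √Lam))
          (Metric.ball (0 : EuclideanSpace ℝ (Fin d)) (1 / 2)) ∧
        IntegrableOn (fun x => |u x| ^ (-(c' / √Lam)))
          (Metric.ball (0 : EuclideanSpace ℝ (Fin d)) (1 / 2)) ∧
        (⨍ x in Metric.ball (0 : EuclideanSpace ℝ (Fin d)) (1 / 2), |u x| ^ (c' / √Lam)) *
          (⨍ x in Metric.ball (0 : EuclideanSpace ℝ (Fin d)) (1 / 2), |u x| ^ (-(c' / √Lam)))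
          ≤ C' := by
  obtain ⟨c, hc, h⟩ := EllipticPDE.exists_lintegral_rpow_mul_le d
  set B : Set (EuclideanSpace ℝ (Fin d)) := Metric.ball 0 (1 / 2) with hB
  set E := EllipticPDE.expConst (volume : Measure (EuclideanSpace ℝ (Fin d))) with hE
  have hEt : E ^ 2 ≠ ∞ := ENNReal.pow_ne_top (EllipticPDE.expConst_ne_top volume)
  have hB0 : volume B ≠ 0 := (Metric.measure_ball_pos _ _ (by norm_num)).ne'
  have hV : 0 < volume.real B := ENNReal.toReal_pos hB0 measure_ball_lt_top.ne
  refine ⟨c, (volume.real B)⁻¹ ^ 2 * (E ^ 2).toReal + 1, hc, by positivity, ?_⟩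
  intro Lam a u ha hu hpos
  have hrest : volume.restrict B
      ≤ volume.restrict (Metric.ball (0 : EuclideanSpace ℝ (Fin d)) 1) :=
    Measure.restrict_mono (Metric.ball_subset_ball (by norm_num)) le_rfl
  have hposB : ∀ᵐ x ∂volume.restrict B, 0 < u x := ae_mono hrest hpos
  have hum : AEMeasurable u (volume.restrict B) := (hu.1.1.1.mono_measure hrest).aemeasurable
  have : NeZero (volume.restrict B) := ⟨by rwa [Ne, Measure.restrict_eq_zero]⟩
  set s := c / √Lam with hs
  obtain ⟨hprod, hA, hA'⟩ := EllipticPDE.lintegral_rpow_mul_le_of_add hum hposB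
    (c := s) (by positivity) hEt (h Lam a u ha hu hpos)
  have hm : ∀ t : ℝ, AEStronglyMeasurable (fun x => |u x| ^ t) (volume.restrict B) := fun t =>
    (hum.abs.pow_const t).aestronglyMeasurable
  have habs : ∀ t : ℝ, ∫⁻ x in B, ENNReal.ofReal (|u x| ^ t)
      = ∫⁻ x in B, ENNReal.ofReal (u x ^ t) := fun t => by
    refine lintegral_congr_ae ?_
    filter_upwards [hposB] with x hx
    rw [abs_of_pos hx]
  have hnn : ∀ t : ℝ, 0 ≤ᵐ[volume.restrict B] fun x => |u x| ^ t := fun t =>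
    ae_of_all _ fun x => Real.rpow_nonneg (abs_nonneg _) t
  have hint : ∀ t : ℝ, ∫⁻ x in B, ENNReal.ofReal (u x ^ t) ≠ ∞ →
      IntegrableOn (fun x => |u x| ^ t) B := fun t ht =>
    (lintegral_ofReal_ne_top_iff_integrable (hm t) (hnn t)).1 (by rwa [habs t])
  refine ⟨hint _ hA, hint _ hA', ?_⟩
  rw [setAverage_eq, setAverage_eq, integral_eq_lintegral_of_nonneg_ae (hnn _) (hm _),
    integral_eq_lintegral_of_nonneg_ae (hnn _) (hm _), habs, habs, smul_eq_mul, smul_eq_mul]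
  have h1 := ENNReal.toReal_mono hEt hprod
  rw [ENNReal.toReal_mul] at h1
  have h2 := mul_le_mul_of_nonneg_left h1 (sq_nonneg (volume.real B)⁻¹)
  linarith
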